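/- Let $(X,d)$ be a locally compact, separable, complete metric space with at least two points, let $m$ be a Radon measure on $X$ with full support, and let $p\in(1,\infty)$. Write $B(x,r)=\{y: d(x,y)<r\}$ and $u_A=\frac1{m(A)}\int_A u\,dm$. A function $E\ge 0$ on a real vector space is called a $p$-energy form if $E^{1/p}$ is a seminorm. Let $\mathcal F_p$ be a linear subspace of $L^p(X,m)$, let $\mathcal E_p:\mathcal F_p\to[0,\infty)$ be a $p$-energy form, and let $\{\Gamma_p\langle u\rangle\}_{u\in\mathcal F_p}$ be finite Borel measures on $X$ such that: 1. if $u\in\mathcal F_p$ and $\varphi:\mathbb R\to\mathbb R$ is $1$-Lipschitz with $\varphi(0)=0$, then $\varphi(u)\in\mathcal F_p$ and $\mathcal E_p(\varphi(u))\le\mathcal E_p(u)$; and if $\mathcal E_p(u)=0$, then $u$ is constant $m$-a.e.; 2. $\mathcal F_p$ with the norm $\|u\|_{L^p}+\mathcal E_p(u)^{1/p}$ is a reflexive Banach space; 3. $\mathcal F_p\cap C_c(X)$ is dense in $\mathcal F_p$, and uniformly dense in $C_c(X)$; 4. for every Borel set $A$, $u\mapsto\Gamma_p\langle u\rangle(A)$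 is a $p$-energy form on $\mathcal F_p$; 5. $\mathcal E_p(u)=\Gamma_p\langle u\rangle(X)$ for all $u\in\mathcal F_p$; 6. if $u,v\in\mathcal F_p\cap C_c(X)$ and $u-v$ is constant on an open set $U$, then $\Gamma_p\langle u\rangle$ and $\Gamma_p\langle v\rangle$ agree on the Borel subsets of $U$. Assume that, for some $\beta\in(0,\infty)$, the following three conditions hold. * (VD) There is $c\ge1$ with $m(B(x,2r))\le c\,m(B(x,r))$ for all $x\in X$, $r>0$. * (PI$_p(\beta)$) There are $C>0$, $A\ge1$ with $\int_{B(x,r)}|u-u_{B(x,r)}|^p\,dm\le C r^\beta\,\Gamma_p\langle u\rangle(B(x,Ar))$ for all $x\in X$, $r>0$, $u\in\mathcal F_p$. * (cap$_p(\beta)_\le$) There are $C,A_1,A_2>1$ such that for all $x\in X$ and $0<R<\operatorname{diam}(X)/A_2$, $$\inf\{\mathcal E_p(u): u\in\mathcal F_p,\ u=1\ m\text{-a.e. on }B(x,R),\ u=0\ m\text{-a.e. on }X\setminus B(x,A_1R)\}\le C\,\frac{m(B(x,R))}{R^\beta},$$ where $\inf\emptyset=\infty$. For $\theta>0$ let $B^\theta_{p,p}(X)$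 be the set of $u\in L^p(X,m)$ with $$\int_X\int_X\frac{|u(x)-u(y)|^p}{d(x,y)^{p\theta}\,m(B(y,d(x,y)))}\,m(dx)\,m(dy)<\infty$$ (the integrand being $0$ for $x=y$), and let $B^\theta_{p,\infty}(X)$ be the set of $u\in L^p(X,m)$ with $$\sup_{r>0}\int_X\frac1{m(B(y,r))}\int_{B(y,r)}\frac{|u(x)-u(y)|^p}{r^{p\theta}}\,m(dx)\,m(dy)<\infty.$$ Define, with suprema in $[0,\infty]$ and $\sup\emptyset=0$, $$\alpha_p(X)=\sup\{\theta>0: B^\theta_{p,\infty}(X)\text{ contains a non-constant function}\},\qquad \alpha_p^*(X)=\sup\{\theta>0: B^\theta_{p,\infty}(X)\text{ is dense in }L^p(X,m)\},$$ and let $\alpha_{p,p}(X)$, $\alpha_{p,p}^*(X)$ be defined in the same way with $B^\theta_{p,p}(X)$ in place of $B^\theta_{p,\infty}(X)$; here non-constant means not $m$-a.e. equal to a constant. Then $$\alpha_p(X)=\alpha_p^*(X)=\alpha_{p,p}(X)=\alpha_{p,p}^*(X)=\frac{\beta}{p}.$$ -/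

import Mathlib

open MeasureTheory Set
open scoped ENNReal NNReal

/-- The exponent `p ∈ (1, ∞)` satisfies `1 ≤ p`, so that `Lᵖ` carries its norm. -/
instance instFactOneLeOfReal (p : ℝ) [hp : Fact (1 < p)] : Fact (1 ≤ ENNReal.ofReal p) :=
  ⟨ENNReal.one_le_ofReal.2 hp.out.le⟩

/-- `E : V → [0, ∞)` is a `p`-energy form if `E ^ (1 / p)` is a seminorm on `V`. -/
def IsPEnergyForm (p : ℝ) {V : Type*} [AddCommGroup V] [Module ℝ V] (E : V → ℝ) : Prop :=
  (∀ u, 0 ≤ E u) ∧ ∃ q : Seminorm ℝ V, ∀ u, q u = E u ^ (1 / p)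

/-- A `p`-energy form `(E, F)` on `(X, m)` whose domain `F` is a linear subspace of `Lᵖ(X, m)`. -/
structure PEnergyForm {X : Type*} [MeasurableSpace X] (p : ℝ) [Fact (1 < p)]
    (m : Measure X) where
  /-- the domain `F` -/
  domain : Submodule ℝ (Lp ℝ (ENNReal.ofReal p) m)
  /-- the energy `E` -/
  energy : domain → ℝ
  isPEnergyForm : IsPEnergyForm p energy

namespace PEnergyForm

variable {X : Type*} [MeasurableSpace X] {p : ℝ} [Fact (1 < p)] {m : Measure X}

/-- A copy of the domain `F` that is normed by `‖u‖_{Lᵖ} + E(u) ^ (1 / p)` (whereas `𝓔.domain`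
inherits the `Lᵖ` norm). -/
def Space (𝓔 : PEnergyForm p m) : Type _ := 𝓔.domain

noncomputable instance (𝓔 : PEnergyForm p m) : AddCommGroup 𝓔.Space :=
  inferInstanceAs (AddCommGroup 𝓔.domain)

noncomputable instance (𝓔 : PEnergyForm p m) : Module ℝ 𝓔.Space :=
  inferInstanceAs (Module ℝ 𝓔.domain)

/-- The underlying element of `𝓔.domain`. -/
def Space.toDomain {𝓔 : PEnergyForm p m} (u : 𝓔.Space) : 𝓔.domain := u

noncomputable instance (𝓔 : PEnergyForm p m) : Norm 𝓔.Space :=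
  ⟨fun u => ‖(u.toDomain : Lp ℝ (ENNReal.ofReal p) m)‖ + 𝓔.energy u.toDomain ^ (1 / p)⟩

theorem Space.norm_def {𝓔 : PEnergyForm p m} (u : 𝓔.Space) :
    ‖u‖ = ‖(u.toDomain : Lp ℝ (ENNReal.ofReal p) m)‖ + 𝓔.energy u.toDomain ^ (1 / p) := rfl

theorem Space.normedSpaceCore (𝓔 : PEnergyForm p m) : NormedSpace.Core ℝ 𝓔.Space := by
  obtain ⟨-, q, hq⟩ := 𝓔.isPEnergyForm
  have hn : ∀ u : 𝓔.Space, ‖u‖ = ‖u.toDomain‖ + q u.toDomain := fun u => by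
    rw [Space.norm_def, hq]; rfl
  refine ⟨⟨fun u => ?_, fun c u => ?_, fun u v => ?_⟩, fun u => ⟨fun h => ?_, fun h => ?_⟩⟩
  · rw [hn]
    exact add_nonneg (norm_nonneg _) (apply_nonneg q _)
  · rw [hn, hn]
    have h1 : (c • u).toDomain = c • u.toDomain := rfl
    rw [h1, norm_smul, map_smul_eq_mul]
    ring
  · rw [hn, hn, hn]
    have h1 : (u + v).toDomain = u.toDomain + v.toDomain := rfl
    rw [h1]
    linarith [norm_add_le u.toDomain v.toDomain, map_add_le_add q u.toDomain v.toDomain]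
  · rw [hn] at h
    have h1 : ‖u.toDomain‖ = 0 := by
      linarith [norm_nonneg u.toDomain, apply_nonneg q u.toDomain]
    exact norm_eq_zero.1 h1
  · rw [hn, h]
    have h1 : (0 : 𝓔.Space).toDomain = 0 := rfl
    rw [h1, norm_zero, map_zero, add_zero]

noncomputable instance (𝓔 : PEnergyForm p m) : NormedAddCommGroup 𝓔.Space :=
  NormedAddCommGroup.ofCore (Space.normedSpaceCore 𝓔)

noncomputable instance (𝓔 : PEnergyForm p m) : NormedSpace ℝ 𝓔.Space :=
  NormedSpace.ofCore (Space.normedSpaceCore 𝓔)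

end PEnergyForm

/-- A `p`-energy form `(E, F)` on the metric measure space `(X, m)`, with `F ⊆ Lᵖ(X, m)`, together
with a family `Γ` of `p`-energy measures indexed by `F`. -/
structure IsEnergyFramework {X : Type*} [MetricSpace X] [MeasurableSpace X] {p : ℝ}
    [Fact (1 < p)] {m : Measure X} (𝓔 : PEnergyForm p m) (Γ : 𝓔.domain → Measure X) : Prop where
  finite_measure : ∀ u, IsFiniteMeasure (Γ u)
  /-- Lipschitz contraction: `E (φ ∘ u) ≤ E u` for `1`-Lipschitz `φ` with `φ 0 = 0`. -/
  lipschitz_contraction : ∀ (u : 𝓔.domain) (φ : ℝ → ℝ) (hφ : LipschitzWith 1 φ) (h0 : φ 0 = 0),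
    ∃ h : hφ.compLp h0 (u : Lp ℝ (ENNReal.ofReal p) m) ∈ 𝓔.domain, 𝓔.energy ⟨_, h⟩ ≤ 𝓔.energy u
  /-- Functions of zero energy are constant. -/
  const_of_energy_eq_zero : ∀ u : 𝓔.domain, 𝓔.energy u = 0 →
    ∃ c : ℝ, ∀ᵐ x ∂m, (u : Lp ℝ (ENNReal.ofReal p) m) x = c
  /-- `F` is a Banach space. -/
  complete : CompleteSpace 𝓔.Space
  /-- `F` is reflexive. -/
  reflexive : Function.Surjective (NormedSpace.inclusionInDoubleDual ℝ 𝓔.Space)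
  /-- `F ∩ C_c(X)` is dense in `F`. -/
  dense_core : Dense {u : 𝓔.Space | ∃ f : X → ℝ, Continuous f ∧ HasCompactSupport f ∧
    (u.toDomain : Lp ℝ (ENNReal.ofReal p) m) =ᵐ[m] f}
  /-- `F ∩ C_c(X)` is uniformly dense in `C_c(X)`. -/
  uniformly_dense : ∀ g : X → ℝ, Continuous g → HasCompactSupport g → ∀ ε > 0,
    ∃ (u : 𝓔.domain) (f : X → ℝ), Continuous f ∧ HasCompactSupport f ∧
      (u : Lp ℝ (ENNReal.ofReal p) m) =ᵐ[m] f ∧ ∀ x, |f x - g x| < ε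
  /-- `u ↦ Γ⟨u⟩(A)` is a `p`-energy form for every Borel set `A`. -/
  isPEnergyForm_measure : ∀ A : Set X, MeasurableSet A →
    IsPEnergyForm p (fun u : 𝓔.domain => (Γ u).real A)
  energy_eq : ∀ u : 𝓔.domain, 𝓔.energy u = (Γ u).real univ
  /-- Strong locality of the energy measures. -/
  strongly_local : ∀ (u v : 𝓔.domain) (f g : X → ℝ),
    Continuous f → HasCompactSupport f → (u : Lp ℝ (ENNReal.ofReal p) m) =ᵐ[m] f →
    Continuous g → HasCompactSupport g → (v : Lp ℝ (ENNReal.ofReal p) m) =ᵐ[m] g →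
    ∀ U : Set X, IsOpen U → (∃ c : ℝ, ∀ x ∈ U, f x - g x = c) →
      (Γ u).restrict U = (Γ v).restrict U

/-- The volume doubling property (VD). -/
def VolumeDoubling {X : Type*} [MetricSpace X] [MeasurableSpace X] (m : Measure X) : Prop :=
  ∃ c : ℝ, 1 ≤ c ∧ ∀ (x : X) (r : ℝ), 0 < r →
    m (Metric.ball x (2 * r)) ≤ ENNReal.ofReal c * m (Metric.ball x r)

/-- The `(p, p)`-Poincaré inequality with scale function `Ψ`. -/
def PoincareInequality {X : Type*} [MetricSpace X] [MeasurableSpace X] {p : ℝ} [Fact (1 < p)]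
    {m : Measure X} (𝓔 : PEnergyForm p m) (Γ : 𝓔.domain → Measure X) (Ψ : ℝ → ℝ) : Prop :=
  ∃ C A : ℝ, 0 < C ∧ 1 ≤ A ∧ ∀ (x : X) (r : ℝ), 0 < r → ∀ u : 𝓔.domain,
    (∫⁻ y in Metric.ball x r, ENNReal.ofReal
        (|(u : Lp ℝ (ENNReal.ofReal p) m) y -
          ⨍ z in Metric.ball x r, (u : Lp ℝ (ENNReal.ofReal p) m) z ∂m| ^ p) ∂m)
      ≤ ENNReal.ofReal (C * Ψ r) * Γ u (Metric.ball x (A * r))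

/-- `F(E₁, E₀)`: the functions of `F` that are `1` a.e. on `E₁` and `0` a.e. on `E₀`. -/
def cutoffFunctions {X : Type*} [MeasurableSpace X] {p : ℝ} [Fact (1 < p)]
    {m : Measure X} (𝓔 : PEnergyForm p m) (E₁ E₀ : Set X) : Set 𝓔.domain :=
  {u | (∀ᵐ x ∂m, x ∈ E₁ → (u : Lp ℝ (ENNReal.ofReal p) m) x = 1) ∧
    (∀ᵐ x ∂m, x ∈ E₀ → (u : Lp ℝ (ENNReal.ofReal p) m) x = 0)}

/-- The `p`-capacity upper estimate with scale function `Ψ` (an empty infimum is `∞`). -/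
def CapacityUpperEstimate {X : Type*} [MetricSpace X] [MeasurableSpace X] {p : ℝ} [Fact (1 < p)]
    {m : Measure X} (𝓔 : PEnergyForm p m) (Ψ : ℝ → ℝ) : Prop :=
  ∃ C A₁ A₂ : ℝ, 1 < C ∧ 1 < A₁ ∧ 1 < A₂ ∧ ∀ (x : X) (R : ℝ), 0 < R →
    ENNReal.ofReal R < Metric.ediam (univ : Set X) / ENNReal.ofReal A₂ →
    (⨅ u ∈ cutoffFunctions 𝓔 (Metric.ball x R) (Metric.ball x (A₁ * R))ᶜ,
        ENNReal.ofReal (𝓔.energy u))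
      ≤ ENNReal.ofReal C * (m (Metric.ball x R) / ENNReal.ofReal (Ψ R))

section Besov

variable {X : Type*} [MetricSpace X] [MeasurableSpace X]

/-- `E_{p,θ}(u, r) = ∫_X ⨍_{B(y,r)} |u(x) - u(y)|ᵖ / r^{pθ} m(dx) m(dy)`. -/
noncomputable def besovEnergy (p θ : ℝ) (m : Measure X) (u : X → ℝ) (r : ℝ) : ℝ≥0∞ :=
  ∫⁻ y, (⨍⁻ x in Metric.ball y r, ENNReal.ofReal (|u x - u y| ^ p / r ^ (p * θ)) ∂m) ∂m

/-- The Besov space `B^θ_{p,∞}(X)`, as a subset of `Lᵖ(X, m)`. -/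
def besovInfty (p θ : ℝ) (m : Measure X) : Set (Lp ℝ (ENNReal.ofReal p) m) :=
  {u | (⨆ (r : ℝ) (_ : 0 < r), besovEnergy p θ m u r) < ∞}

/-- The Besov space `B^θ_{p,p}(X)`, as a subset of `Lᵖ(X, m)`. On the diagonal the integrand is
`0 / 0 = 0`. -/
def besovPP (p θ : ℝ) (m : Measure X) : Set (Lp ℝ (ENNReal.ofReal p) m) :=
  {u | (∫⁻ y, (∫⁻ x, ENNReal.ofReal (|u x - u y| ^ p) /
    (ENNReal.ofReal (dist x y ^ (p * θ)) * m (Metric.ball y (dist x y))) ∂m) ∂m) < ∞}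

/-- The set `B ⊆ Lᵖ(X, m)` contains a function that is not a.e. equal to a constant. -/
def ContainsNonconstant {p : ℝ≥0∞} {m : Measure X} (B : Set (Lp ℝ p m)) : Prop :=
  ∃ u ∈ B, ¬ ∃ c : ℝ, ∀ᵐ x ∂m, u x = c

/-- `α_p(X)`; as for the other exponents, the supremum is taken in `[0, ∞]`, with `sup ∅ = 0`. -/
noncomputable def besovExponent (p : ℝ) (m : Measure X) : ℝ≥0∞ :=
  ⨆ (θ : ℝ) (_ : 0 < θ ∧ ContainsNonconstant (besovInfty p θ m)), ENNReal.ofReal θ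

/-- `α_p^*(X)`. -/
noncomputable def besovExponentStar (p : ℝ) [Fact (1 < p)] (m : Measure X) : ℝ≥0∞ :=
  ⨆ (θ : ℝ) (_ : 0 < θ ∧ Dense (besovInfty p θ m)), ENNReal.ofReal θ

/-- `α_{p,p}(X)`. -/
noncomputable def besovExponentPP (p : ℝ) (m : Measure X) : ℝ≥0∞ :=
  ⨆ (θ : ℝ) (_ : 0 < θ ∧ ContainsNonconstant (besovPP p θ m)), ENNReal.ofReal θ

/-- `α_{p,p}^*(X)`. -/
noncomputable def besovExponentPPStar (p : ℝ) [Fact (1 < p)] (m : Measure X) : ℝ≥0∞ :=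
  ⨆ (θ : ℝ) (_ : 0 < θ ∧ Dense (besovPP p θ m)), ENNReal.ofReal θ

end Besov

/-! ### Geometry of doubling spaces: packing, nets, bounded overlap. -/

section Doubling

open Metric

variable {X : Type*} [MetricSpace X] [MeasurableSpace X] {m : Measure X}

/-! Write `ballEnergy` for the integrated mean `p`-oscillation of `u` at scale `r`; membership in
`B^θ_{p,∞}` means that it is `O(r^{pθ})`. The value `β/p` comes from two opposite comparisons
between `ballEnergy` and the energy form.

Lower bound: covering `X` by balls of radius `r` with bounded overlap and applying the Poincaré
inequality on each gives `ballEnergy u r ≤ C r^β E(u)` (`exists_ballEnergy_le_energy`). So the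
domain, which is dense in `Lᵖ`, lies in `B^{β/p}_{p,∞}`, and a dyadic sum puts it in `B^θ_{p,p}` for
every `θ < β/p` (`besovInfty_subset_besovPP`).

Upper bound: the capacity estimate yields partitions of unity at scale `r` whose members have energy
at most a constant times `m(B)/r^β`. The discrete convolution `v_r` of `u` (ball averages glued by
the partition) then satisfies, on any bounded ball, `Γ⟨v_r⟩ ≤ C r^{-β} ballEnergy u (Λr)`, and is
within `C ballEnergy u (Λr)` of `u` in `p`-th power (`exists_approximation`). If `u` lies in
`B^θ_{p,∞}` with `θ > β/p`, both bounds tend to `0`; the Poincaré inequality on a fixed ball makes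
`v_r` nearly constant there, so `u` is constant (`exists_ae_eq_const_of_mem_besovInfty`).

The partition must consist of continuous compactly supported functions, because locality of `Γ` is
assumed only for these, whereas the capacity supplies arbitrary members of the domain.
`exists_core_cutoff` closes this gap by reflexivity. The partition is built from successive maxima
rather than products or quotients, so Lipschitz contraction alone controls its energy. -/

theorem VolumeDoubling.measure_ball_two_pow_le (h : VolumeDoubling m) :
    ∃ c : ℝ≥0, 1 ≤ c ∧ ∀ (k : ℕ) (x : X) (r : ℝ), 0 < r →
      m (ball x (2 ^ k * r)) ≤ (c : ℝ≥0∞) ^ k * m (ball x r) := by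
  obtain ⟨c, hc, h⟩ := h
  refine ⟨c.toNNReal, by simpa using hc, fun k => ?_⟩
  induction k with
  | zero => intro x r _; simp
  | succ k ih =>
    intro x r hr
    have e : (2 : ℝ) ^ (k + 1) * r = 2 * (2 ^ k * r) := by ring
    calc m (ball x (2 ^ (k + 1) * r)) ≤ ENNReal.ofReal c * m (ball x (2 ^ k * r)) := by
          rw [e]; exact h x _ (by positivity)
      _ ≤ ENNReal.ofReal c * (ENNReal.ofReal c ^ k * m (ball x r)) := by gcongr; exact ih x r hr
      _ = _ := by rw [← mul_assoc, pow_succ']; rfl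

/-- Balls of comparable radii and centres have comparable measures. -/
theorem VolumeDoubling.comparable (h : VolumeDoubling m) (Λ : ℝ) :
    ∃ K : ℝ≥0, 1 ≤ K ∧ ∀ (x y : X) (r : ℝ), 0 < r → dist x y ≤ Λ * r →
      m (ball x (Λ * r)) ≤ K * m (ball y r) := by
  obtain ⟨c, hc, h⟩ := h.measure_ball_two_pow_le
  obtain ⟨k, hk⟩ := pow_unbounded_of_one_lt (2 * Λ) one_lt_two
  refine ⟨c ^ k, one_le_pow₀ hc, fun x y r hr hxy => ?_⟩
  refine (measure_mono (ball_subset_ball' ?_)).trans ((h k y r hr).trans (by simp))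
  nlinarith

theorem VolumeDoubling.measure_ball_lt_top [IsLocallyFiniteMeasure m] (h : VolumeDoubling m)
    (x : X) (r : ℝ) : m (ball x r) < ∞ := by
  obtain ⟨c, hc, h⟩ := h.measure_ball_two_pow_le
  obtain ⟨s, hs, hfin⟩ := m.finiteAt_nhds x
  obtain ⟨ε, hε, hb⟩ := Metric.mem_nhds_iff.1 hs
  obtain ⟨k, hk⟩ := pow_unbounded_of_one_lt (r / ε) one_lt_two
  calc m (ball x r) ≤ m (ball x (2 ^ k * ε)) :=
        measure_mono (ball_subset_ball ((div_lt_iff₀ hε).1 hk).le)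
    _ ≤ (c : ℝ≥0∞) ^ k * m (ball x ε) := h k x ε hε
    _ < ∞ := ENNReal.mul_lt_top (by simp) ((measure_mono hb).trans_lt hfin)

variable [BorelSpace X]

/-- A finite set is `r`-separated if its points have mutual distances at least `r`. -/
def SeparatedBy {X : Type*} [MetricSpace X] (r : ℝ) (S : Finset X) : Prop :=
  ∀ x ∈ S, ∀ y ∈ S, x ≠ y → r ≤ dist x y

/-- Volume packing: the balls of radius `r/2` about the points are disjoint, lie in one ball about
`y`, and each has measure comparable to that ball. -/
theorem VolumeDoubling.card_le [IsLocallyFiniteMeasure m] [m.IsOpenPosMeasure]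
    (h : VolumeDoubling m) (Λ : ℝ) :
    ∃ N : ℕ, ∀ (r : ℝ), 0 < r → ∀ (y : X) (S : Finset X), SeparatedBy r S →
      (∀ x ∈ S, dist x y < Λ * r) → S.card ≤ N := by
  -- At scale `r/2` this factor gives the radius `(|Λ| + 1) r`, large enough to contain all the
  -- half-balls; the absolute value covers negative `Λ`.
  obtain ⟨K, -, hK⟩ := h.comparable (2 * (|Λ| + 1))
  refine ⟨⌈K⌉₊, fun r hr y S hS hy => ?_⟩
  have hΛ := le_abs_self Λ
  have hΛ0 := abs_nonneg Λ
  set M := m (ball y (2 * (|Λ| + 1) * (r / 2)))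
  have hM0 : M ≠ 0 := (measure_ball_pos m y (by positivity)).ne'
  have hM1 : M ≠ ∞ := (h.measure_ball_lt_top _ _).ne
  have hdisj : (S : Set X).PairwiseDisjoint fun x => ball x (r / 2) := by
    intro a ha b hb hab
    exact ball_disjoint_ball (by linarith [hS a ha b hb hab])
  have hsum : ∑ x ∈ S, m (ball x (r / 2)) ≤ M := by
    rw [← measure_biUnion_finset hdisj fun _ _ => measurableSet_ball]
    refine measure_mono (iUnion₂_subset fun x hx => ball_subset_ball' ?_)
    have := hy x hx
    nlinarith
  have h2 : (S.card : ℝ≥0∞) * M ≤ K * M := by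
    calc (S.card : ℝ≥0∞) * M = ∑ x ∈ S, M := by simp
      _ ≤ ∑ x ∈ S, K * m (ball x (r / 2)) := by
          refine Finset.sum_le_sum fun x hx => hK y x _ (by positivity) ?_
          have := hy x hx
          rw [dist_comm]; nlinarith
      _ ≤ K * M := by rw [← Finset.mul_sum]; gcongr
  have h3 : (S.card : ℝ≥0∞) ≤ K := (ENNReal.mul_le_mul_iff_left hM0 hM1).1 h2
  have h4 : (S.card : ℝ≥0) ≤ K := by exact_mod_cast h3
  exact_mod_cast h4.trans (Nat.le_ceil K)

/-- A separated subset of the ball with the greatest cardinality works: the packing bound makes this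
cardinality exist, and an uncovered point could be added to the set. -/
theorem VolumeDoubling.exists_net [IsLocallyFiniteMeasure m] [m.IsOpenPosMeasure]
    (h : VolumeDoubling m) (x₀ : X) (R : ℝ) {r : ℝ} (hr : 0 < r) :
    ∃ S : Finset X, SeparatedBy r S ∧ ∀ y ∈ ball x₀ R, ∃ x ∈ S, y ∈ ball x r := by
  classical
  obtain ⟨N, hN⟩ := h.card_le (R / r)
  let P : ℕ → Prop := fun n => ∃ S : Finset X, SeparatedBy r S ∧ (∀ x ∈ S, dist x x₀ < R) ∧
    S.card = n
  have hP0 : P 0 := ⟨∅, by simp [SeparatedBy], by simp, rfl⟩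
  have hPN : ∀ n, P n → n ≤ N := by
    rintro n ⟨S, h1, h2, rfl⟩
    exact hN r hr x₀ S h1 fun x hx => by rw [div_mul_cancel₀ _ hr.ne']; exact h2 x hx
  obtain ⟨S, h1, h2, h3⟩ := Nat.findGreatest_spec (P := P) (Nat.zero_le N) hP0
  refine ⟨S, h1, fun y hy => ?_⟩
  by_contra! hcon
  have hyS : y ∉ S := fun hyS => hcon y hyS (mem_ball_self hr)
  have hfar : ∀ x ∈ S, r ≤ dist y x := fun x hx => by simpa using hcon x hx
  have hins : P (S.card + 1) := by
    refine ⟨insert y S, ?_, ?_, Finset.card_insert_of_notMem hyS⟩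
    · intro a ha b hb hab
      rcases Finset.mem_insert.1 ha with rfl | ha' <;> rcases Finset.mem_insert.1 hb with rfl | hb'
      · exact absurd rfl hab
      · exact hfar b hb'
      · rw [dist_comm]; exact hfar a ha'
      · exact h1 a ha' b hb' hab
    · intro x hx
      rcases Finset.mem_insert.1 hx with rfl | hx
      · exact hy
      · exact h2 x hx
  have := Nat.le_findGreatest (hPN _ hins) hins
  omega

/-- Balls around separated points have bounded overlap. -/
theorem VolumeDoubling.sum_measure_ball_le [IsLocallyFiniteMeasure m] [m.IsOpenPosMeasure]
    (h : VolumeDoubling m) (Λ : ℝ) :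
    ∃ N : ℕ, ∀ (r : ℝ), 0 < r → ∀ (S : Finset X), SeparatedBy r S → ∀ μ : Measure X,
      ∑ x ∈ S, μ (ball x (Λ * r)) ≤ N * μ univ := by
  classical
  obtain ⟨N, hN⟩ := h.card_le Λ
  refine ⟨N, fun r hr S hS μ => ?_⟩
  -- The sum is the integral of the function counting the centres within `Λr` of `y`, which the
  -- packing bound controls.
  have e : ∀ x ∈ S, μ (ball x (Λ * r)) = ∫⁻ y, (ball x (Λ * r)).indicator 1 y ∂μ := fun x _ => by
    rw [lintegral_indicator_one measurableSet_ball]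
  rw [Finset.sum_congr rfl e,
    ← lintegral_finsetSum _ fun x _ => measurable_one.indicator measurableSet_ball,
    ← lintegral_const]
  refine lintegral_mono fun y => ?_
  have e2 : ∑ x ∈ S, (ball x (Λ * r)).indicator (1 : X → ℝ≥0∞) y
      = ((S.filter fun x => dist x y < Λ * r).card : ℝ≥0∞) := by
    simp [indicator_apply, dist_comm]
  rw [e2]
  refine Nat.cast_le.2 (hN r hr y _ (fun a ha b hb => hS a (Finset.mem_filter.1 ha).1 b
    (Finset.mem_filter.1 hb).1) fun x hx => (Finset.mem_filter.1 hx).2)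

theorem VolumeDoubling.sum_setLIntegral_ball_le [IsLocallyFiniteMeasure m] [m.IsOpenPosMeasure]
    (h : VolumeDoubling m) (Λ : ℝ) :
    ∃ N : ℕ, ∀ (r : ℝ), 0 < r → ∀ (S : Finset X), SeparatedBy r S → ∀ g : X → ℝ≥0∞,
      ∑ x ∈ S, ∫⁻ y in ball x (Λ * r), g y ∂m ≤ N * ∫⁻ y, g y ∂m := by
  obtain ⟨N, hN⟩ := h.sum_measure_ball_le Λ
  refine ⟨N, fun r hr S hS g => ?_⟩
  have := hN r hr S hS (m.withDensity g)
  simpa [withDensity_apply, measurableSet_ball] using this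

/-- Finite nets make closed balls totally bounded, and completeness makes them compact; this is what
Urysohn functions on balls need. -/
theorem VolumeDoubling.properSpace [CompleteSpace X] [IsLocallyFiniteMeasure m]
    [m.IsOpenPosMeasure] (h : VolumeDoubling m) : ProperSpace X := by
  refine ⟨fun x R => ?_⟩
  refine isCompact_iff_totallyBounded_isComplete.2 ⟨?_, isClosed_closedBall.isComplete⟩
  refine Metric.totallyBounded_iff.2 fun ε hε => ?_
  obtain ⟨S, -, hS⟩ := h.exists_net x (R + 1) hε
  refine ⟨S, S.finite_toSet, fun y hy => ?_⟩
  obtain ⟨z, hz, hyz⟩ := hS y (mem_ball.2 (by linarith [mem_closedBall.1 hy]))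
  exact mem_biUnion hz hyz

end Doubling

theorem ENNReal.inv_le_mul_inv_of_le_mul {a b K : ℝ≥0∞} (h0 : a ≠ 0) (h1 : a ≠ ∞)
    (h : a ≤ K * b) : b⁻¹ ≤ K * a⁻¹ := by
  rw [← div_eq_mul_inv, ENNReal.le_div_iff_mul_le (Or.inl h0) (Or.inl h1), mul_comm,
    ← div_eq_mul_inv]
  exact ENNReal.div_le_of_le_mul h

/-! ### Comparison of the two Besov scales. -/

section BesovSpaces

open Metric

variable {X : Type*} [MetricSpace X] [MeasurableSpace X] {m : Measure X} {p : ℝ}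

/-- The mean `p`-oscillation `⨍_{B(y,r)} |u(x) - u(y)|ᵖ m(dx)`. -/
noncomputable def ballOsc (p : ℝ) (m : Measure X) (u : X → ℝ) (r : ℝ) (y : X) : ℝ≥0∞ :=
  ⨍⁻ x in ball y r, ‖u x - u y‖ₑ ^ p ∂m

/-- The Besov energy at scale `r` without the factor `r^{-pθ}`. -/
noncomputable def ballEnergy (p : ℝ) (m : Measure X) (u : X → ℝ) (r : ℝ) : ℝ≥0∞ :=
  ∫⁻ y, ballOsc p m u r y ∂m

theorem ofReal_abs_rpow (hp : 0 ≤ p) (a : ℝ) : ENNReal.ofReal (|a| ^ p) = ‖a‖ₑ ^ p := by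
  rw [Real.enorm_eq_ofReal_abs, ENNReal.ofReal_rpow_of_nonneg (abs_nonneg a) hp]

theorem besovEnergy_eq (hp : 0 ≤ p) (θ : ℝ) (u : X → ℝ) {r : ℝ} (hr : 0 < r) :
    besovEnergy p θ m u r = ballEnergy p m u r / ENNReal.ofReal (r ^ (p * θ)) := by
  have hs : 0 < r ^ (p * θ) := Real.rpow_pos_of_pos hr _
  have hne : (ENNReal.ofReal (r ^ (p * θ)))⁻¹ ≠ ∞ := by simpa using hs
  simp only [besovEnergy, ballEnergy, ballOsc, ENNReal.ofReal_div_of_pos hs, ofReal_abs_rpow hp,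
    laverage_eq']
  simp only [div_eq_mul_inv, lintegral_mul_const' _ _ hne]

theorem mem_besovInfty_iff (hp : 0 ≤ p) {θ : ℝ} {u : Lp ℝ (ENNReal.ofReal p) m} :
    u ∈ besovInfty p θ m ↔
      ∃ M : ℝ≥0, ∀ r, 0 < r → ballEnergy p m u r ≤ M * ENNReal.ofReal (r ^ (p * θ)) := by
  have key : ∀ (M : ℝ≥0∞) (r : ℝ), 0 < r → (besovEnergy p θ m u r ≤ M ↔
      ballEnergy p m u r ≤ M * ENNReal.ofReal (r ^ (p * θ))) := fun M r hr => by
    rw [besovEnergy_eq hp θ u hr, ENNReal.div_le_iff_le_mul]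
    · left; simpa using Real.rpow_pos_of_pos hr _
    · left; simp
  constructor
  · intro h
    change (⨆ (r : ℝ) (_ : 0 < r), besovEnergy p θ m u r) < ∞ at h
    refine ⟨(⨆ (r : ℝ) (_ : 0 < r), besovEnergy p θ m u r).toNNReal, fun r hr => ?_⟩
    rw [← key _ r hr, ENNReal.coe_toNNReal h.ne]
    exact le_iSup₂ (f := fun (r : ℝ) (_ : 0 < r) => besovEnergy p θ m u r) r hr
  · rintro ⟨M, hM⟩
    exact (iSup₂_le fun r hr => (key M r hr).2 (hM r hr)).trans_lt ENNReal.coe_lt_top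

theorem lintegral_enorm_rpow_lt_top {X : Type*} [MeasurableSpace X] {m : Measure X} [hp : Fact (1 < p)] (u : Lp ℝ (ENNReal.ofReal p) m) :
    ∫⁻ x, ‖u x‖ₑ ^ p ∂m < ∞ := by
  have h0 : 0 < p := zero_lt_one.trans hp.out
  have := lintegral_rpow_enorm_lt_top_of_eLpNorm_lt_top (by simpa using h0) ENNReal.ofReal_ne_top
    (Lp.memLp u).2
  rwa [ENNReal.toReal_ofReal h0.le] at this

theorem enorm_sub_rpow_le (hp : 1 ≤ p) (a b : ℝ) :
    ‖a - b‖ₑ ^ p ≤ 2 ^ (p - 1) * (‖a‖ₑ ^ p + ‖b‖ₑ ^ p) := by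
  exact (ENNReal.rpow_le_rpow (enorm_sub_le (a := a) (b := b)) (by linarith)).trans
    (ENNReal.rpow_add_le_mul_rpow_add_rpow _ _ hp)

variable [BorelSpace X]

/-- For `d(x,y) < r` the weight `d^{pθ} m(B(y,d))` is at most `r^{pθ} m(B(y,r))`, so the double
integral dominates the energy at each scale. -/
theorem besovPP_subset_besovInfty [hp : Fact (1 < p)] [m.IsOpenPosMeasure] {θ : ℝ} (hθ : 0 < θ) :
    besovPP p θ m ⊆ besovInfty p θ m := by
  intro u hu
  have h0 : 0 < p := zero_lt_one.trans hp.out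
  refine (iSup₂_le fun r hr => lintegral_mono fun y => ?_).trans_lt hu
  have hne : (m (ball y r))⁻¹ ≠ ∞ := by simpa using (measure_ball_pos m y hr).ne'
  rw [setLAverage_eq, div_eq_mul_inv, ← lintegral_mul_const' _ _ hne]
  refine (setLIntegral_mono' measurableSet_ball fun x hx => ?_).trans (setLIntegral_le_lintegral _ _)
  rcases eq_or_ne x y with rfl | hxy
  · simp [Real.zero_rpow h0.ne']
  have hd : 0 < dist x y := dist_pos.2 hxy
  have hxr : dist x y < r := hx
  rw [ENNReal.ofReal_div_of_pos (Real.rpow_pos_of_pos hr _), div_eq_mul_inv, div_eq_mul_inv,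
    mul_assoc, ← ENNReal.mul_inv]
  · gcongr
  · left; simpa using Real.rpow_pos_of_pos hr _
  · left; simp

variable [SecondCountableTopology X] [SigmaFinite m]

/-- Second countability makes the open set `{d(x,y) < r}` measurable for the product `σ`-algebra. -/
theorem measurable_measure_ball (r : ℝ) : Measurable fun y => m (ball y r) := by
  have hs : MeasurableSet {q : X × X | dist q.2 q.1 < r} :=
    (isOpen_lt (continuous_snd.dist continuous_fst) continuous_const).measurableSet
  exact measurable_measure_prodMk_left hs

theorem measurable_setLIntegral_ball {f : X → X → ℝ≥0∞} (hf : Measurable (Function.uncurry f))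
    (r : ℝ) : Measurable fun y => ∫⁻ x in ball y r, f y x ∂m := by
  have hs : MeasurableSet {q : X × X | dist q.2 q.1 < r} :=
    (isOpen_lt (continuous_snd.dist continuous_fst) continuous_const).measurableSet
  have h := (hf.indicator hs).lintegral_prod_right' (ν := m)
  have e : (fun y => ∫⁻ x in ball y r, f y x ∂m) = fun y => ∫⁻ x,
      {q : X × X | dist q.2 q.1 < r}.indicator (Function.uncurry f) (y, x) ∂m := by
    ext y
    rw [← lintegral_indicator measurableSet_ball]
    rfl
  rwa [e]

theorem measurable_ballOsc {u : X → ℝ} (hu : Measurable u) (r : ℝ) :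
    Measurable (ballOsc p m u r) := by
  have : ballOsc p m u r = fun y => (∫⁻ x in ball y r, ‖u x - u y‖ₑ ^ p ∂m) / m (ball y r) := by
    ext y; rw [ballOsc, setLAverage_eq]
  rw [this]
  refine Measurable.div ?_ (measurable_measure_ball r)
  refine measurable_setLIntegral_ball (f := fun y x => ‖u x - u y‖ₑ ^ p) ?_ r
  exact (((hu.comp measurable_snd).sub (hu.comp measurable_fst)).enorm).pow_const p

/-- The mean value operator at scale `r` is bounded on nonnegative functions. -/
theorem VolumeDoubling.lintegral_laverage_le [IsLocallyFiniteMeasure m] [m.IsOpenPosMeasure]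
    (h : VolumeDoubling m) : ∃ K : ℝ≥0, ∀ r : ℝ, 0 < r → ∀ g : X → ℝ≥0∞, Measurable g →
      ∫⁻ y, (⨍⁻ x in ball y r, g x ∂m) ∂m ≤ K * ∫⁻ x, g x ∂m := by
  obtain ⟨K, -, hK⟩ := h.comparable 1
  refine ⟨K, fun r hr g hg => ?_⟩
  have hne : ∀ y, (m (ball y r))⁻¹ ≠ ∞ := fun y => by simpa using (measure_ball_pos m y hr).ne'
  have hs : MeasurableSet {q : X × X | dist q.2 q.1 < r} :=
    (isOpen_lt (continuous_snd.dist continuous_fst) continuous_const).measurableSet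
  set F : X × X → ℝ≥0∞ :=
    {q : X × X | dist q.2 q.1 < r}.indicator fun q => g q.2 * (m (ball q.1 r))⁻¹ with hF
  have hFm : Measurable F :=
    ((hg.comp measurable_snd).mul ((measurable_measure_ball r).comp measurable_fst).inv).indicator hs
  calc ∫⁻ y, (⨍⁻ x in ball y r, g x ∂m) ∂m = ∫⁻ y, ∫⁻ x, F (y, x) ∂m ∂m := by
        refine lintegral_congr fun y => ?_
        rw [setLAverage_eq, div_eq_mul_inv, ← lintegral_mul_const' _ _ (hne y),
          ← lintegral_indicator measurableSet_ball]
        rfl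
    _ = ∫⁻ x, ∫⁻ y, F (y, x) ∂m ∂m := lintegral_lintegral_swap hFm.aemeasurable
    _ ≤ ∫⁻ x, K * g x ∂m := by
        refine lintegral_mono fun x => ?_
        have hx0 : m (ball x r) ≠ 0 := (measure_ball_pos m x hr).ne'
        have hx1 : m (ball x r) ≠ ∞ := (h.measure_ball_lt_top x r).ne
        calc ∫⁻ y, F (y, x) ∂m
            ≤ ∫⁻ y, (ball x r).indicator (fun _ => g x * (K * (m (ball x r))⁻¹)) y ∂m := by
              refine lintegral_mono fun y => ?_
              by_cases hxy : dist x y < r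
              · have h1 : (y, x) ∈ {q : X × X | dist q.2 q.1 < r} := hxy
                have h2 : y ∈ ball x r := by rwa [mem_ball, dist_comm]
                simp only [hF, indicator_of_mem h1, indicator_of_mem h2]
                gcongr
                have h3 := hK x y r hr (by linarith)
                rw [one_mul] at h3
                exact ENNReal.inv_le_mul_inv_of_le_mul hx0 hx1 h3
              · have h1 : (y, x) ∉ {q : X × X | dist q.2 q.1 < r} := hxy
                simp [hF, indicator_of_notMem h1]
          _ = g x * (K * (m (ball x r))⁻¹) * m (ball x r) := by
              rw [lintegral_indicator_const measurableSet_ball]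
          _ = K * g x := by
              rw [mul_assoc, mul_assoc, ENNReal.inv_mul_cancel hx0 hx1]; ring
    _ = K * ∫⁻ x, g x ∂m := lintegral_const_mul' _ _ ENNReal.coe_ne_top

/-- Membership in `Lᵖ` alone bounds the oscillation uniformly in the scale; this serves at large
scales, where the bound `r^{pθ}` grows. -/
theorem VolumeDoubling.exists_ballEnergy_le [hp : Fact (1 < p)] [IsLocallyFiniteMeasure m]
    [m.IsOpenPosMeasure] (h : VolumeDoubling m) (u : Lp ℝ (ENNReal.ofReal p) m) :
    ∃ L : ℝ≥0, ∀ r : ℝ, 0 < r → ballEnergy p m u r ≤ L := by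
  obtain ⟨K, hK⟩ := h.lintegral_laverage_le
  have hu : Measurable u := (Lp.stronglyMeasurable u).measurable
  have hup : Measurable fun x => ‖u x‖ₑ ^ p := hu.enorm.pow_const p
  have hfin := lintegral_enorm_rpow_lt_top u
  set I := ∫⁻ x, ‖u x‖ₑ ^ p ∂m
  have hlt : (2 : ℝ≥0∞) ^ (p - 1) * (K * I + I) < ∞ := by
    refine ENNReal.mul_lt_top (ENNReal.rpow_lt_top_of_nonneg (by linarith [hp.out]) (by simp)) ?_
    exact ENNReal.add_lt_top.2 ⟨ENNReal.mul_lt_top (by simp) hfin, hfin⟩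
  refine ⟨((2 : ℝ≥0∞) ^ (p - 1) * (K * I + I)).toNNReal, fun r hr => ?_⟩
  rw [ENNReal.coe_toNNReal hlt.ne]
  have h2 : (2 : ℝ≥0∞) ^ (p - 1) ≠ ∞ :=
    (ENNReal.rpow_lt_top_of_nonneg (by linarith [hp.out]) (by simp)).ne
  calc ballEnergy p m u r
      ≤ ∫⁻ y, 2 ^ (p - 1) * ((⨍⁻ x in ball y r, ‖u x‖ₑ ^ p ∂m) + ‖u y‖ₑ ^ p) ∂m := by
        refine lintegral_mono fun y => ?_
        have h3 : (⨍⁻ _ in ball y r, ‖u y‖ₑ ^ p ∂m) = ‖u y‖ₑ ^ p :=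
          setLAverage_const (measure_ball_pos m y hr).ne' (h.measure_ball_lt_top y r).ne _
        rw [← h3]
        simp only [laverage_eq']
        rw [← lintegral_add_left hup, ← lintegral_const_mul' _ _ h2]
        exact lintegral_mono fun x => enorm_sub_rpow_le hp.out.le _ _
    _ = 2 ^ (p - 1) * ((∫⁻ y, (⨍⁻ x in ball y r, ‖u x‖ₑ ^ p ∂m) ∂m) + I) := by
        rw [lintegral_const_mul' _ _ h2, lintegral_add_right _ hup]
    _ ≤ _ := by gcongr; exact hK r hr _ hup

/-- For `k ≥ 0` the bound `L` leaves a geometric series of ratio `2^{-pθ}`; for `k < 0` the bound `M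
r^{pθ'}` leaves one of ratio `2^{p(θ-θ')}`. -/
theorem tsum_annuli_lt_top {θ θ' : ℝ} (hp : 0 < p) (hθ : 0 < θ) (hθ' : θ < θ') {D : ℝ → ℝ≥0∞}
    {L M : ℝ≥0} (hL : ∀ r, 0 < r → D r ≤ L)
    (hM : ∀ r, 0 < r → D r ≤ M * ENNReal.ofReal (r ^ (p * θ'))) :
    ∑' k : ℤ, (ENNReal.ofReal (((2 : ℝ) ^ k) ^ (p * θ)))⁻¹ * D (2 ^ (k + 1)) < ∞ := by
  have geo : ∀ c s : ℝ, 0 ≤ c → s < 0 →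
      ∑' n : ℕ, ENNReal.ofReal (c * ((2 : ℝ) ^ s) ^ n) < ∞ := fun c s hc hs => by
    have hq : (2 : ℝ) ^ s < 1 := Real.rpow_lt_one_of_one_lt_of_neg one_lt_two hs
    have hq0 : 0 ≤ (2 : ℝ) ^ s := by positivity
    exact ((summable_geometric_of_lt_one hq0 hq).mul_left c).tsum_ofReal_lt_top
  have hz : ∀ (k : ℤ) (s : ℝ), ((2 : ℝ) ^ k) ^ s = 2 ^ (k * s) := fun k s => by
    rw [← Real.rpow_intCast, ← Real.rpow_mul zero_le_two]
  rw [tsum_of_nat_of_neg_add_one ENNReal.summable ENNReal.summable]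
  refine ENNReal.add_lt_top.2 ⟨lt_of_le_of_lt (ENNReal.tsum_le_tsum fun n => ?_)
    (geo L (-(p * θ)) L.2 (by have := mul_pos hp hθ; linarith)),
    lt_of_le_of_lt (ENNReal.tsum_le_tsum fun n => ?_)
    (geo (M * 2 ^ (p * θ)) (p * (θ - θ')) (by positivity) (by nlinarith))⟩
  · rw [← ENNReal.ofReal_inv_of_pos (by positivity), mul_comm (L : ℝ),
      ENNReal.ofReal_mul (by positivity), ENNReal.ofReal_coe_nnreal]
    refine mul_le_mul' (ENNReal.ofReal_le_ofReal (le_of_eq ?_)) (hL _ (by positivity))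
    rw [hz, ← Real.rpow_neg zero_le_two, ← Real.rpow_mul_natCast zero_le_two]
    congr 1; push_cast; ring
  · refine (mul_le_mul_right (hM _ (by positivity)) _).trans (le_of_eq ?_)
    rw [← ENNReal.ofReal_inv_of_pos (by positivity), ← ENNReal.ofReal_coe_nnreal,
      ← ENNReal.ofReal_mul (by positivity), ← ENNReal.ofReal_mul (by positivity)]
    congr 1
    rw [hz, hz, ← Real.rpow_neg zero_le_two, ← Real.rpow_mul_natCast zero_le_two,
      mul_left_comm, mul_assoc, ← Real.rpow_add two_pos, ← Real.rpow_add two_pos]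
    congr 2; push_cast; ring

/-- Cut the inner integral into dyadic annuli about `y`. On each, doubling replaces the weight by
its value at the dyadic radius, leaving a weighted sum of `ballOsc` over scales. -/
theorem besovInfty_subset_besovPP [hp : Fact (1 < p)] [IsLocallyFiniteMeasure m]
    [m.IsOpenPosMeasure] (h : VolumeDoubling m) {θ θ' : ℝ} (hθ : 0 < θ) (hθ' : θ < θ') :
    besovInfty p θ' m ⊆ besovPP p θ m := by
  intro u hu
  have h0 : 0 < p := zero_lt_one.trans hp.out
  obtain ⟨M, hM⟩ := (mem_besovInfty_iff h0.le).1 hu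
  obtain ⟨L, hL⟩ := h.exists_ballEnergy_le u
  obtain ⟨K, -, hK⟩ := h.comparable 2
  have hum : Measurable u := (Lp.stronglyMeasurable u).measurable
  have hlt := tsum_annuli_lt_top h0 hθ hθ' hL hM
  set a : ℤ → ℝ≥0∞ := fun k => (ENNReal.ofReal (((2 : ℝ) ^ k) ^ (p * θ)))⁻¹ with ha
  have hosc : ∀ r, Measurable (ballOsc p m u r) := measurable_ballOsc hum
  have point : ∀ y, (∫⁻ x, ENNReal.ofReal (|u x - u y| ^ p) /
      (ENNReal.ofReal (dist x y ^ (p * θ)) * m (ball y (dist x y))) ∂m)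
      ≤ ∑' k : ℤ, K * (a k * ballOsc p m u (2 ^ (k + 1)) y) := by
    intro y
    have hfm : Measurable fun x => ‖u x - u y‖ₑ ^ p := ((hum.sub_const _).enorm).pow_const p
    have hb0 : ∀ r, 0 < r → m (ball y r) ≠ 0 := fun r hr => (measure_ball_pos m y hr).ne'
    have hb1 : ∀ r, m (ball y r) ≠ ∞ := fun r => (h.measure_ball_lt_top y r).ne
    calc _ ≤ ∫⁻ x, ∑' k : ℤ, (ball y (2 ^ (k + 1))).indicator
            (fun x => ‖u x - u y‖ₑ ^ p * (a k * (m (ball y (2 ^ k)))⁻¹)) x ∂m := by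
          refine lintegral_mono fun x => ?_
          rw [ofReal_abs_rpow h0.le]
          rcases eq_or_ne x y with rfl | hxy
          · simp [ENNReal.zero_rpow_of_pos h0]
          have hd : 0 < dist x y := dist_pos.2 hxy
          -- Only the term of the annulus containing `x` is kept; the other terms are nonnegative.
          obtain ⟨k, hk1, hk2⟩ := exists_mem_Ico_zpow hd one_lt_two
          refine le_trans ?_ (ENNReal.le_tsum k)
          have hx : x ∈ ball y (2 ^ (k + 1)) := hk2
          rw [indicator_of_mem hx, div_eq_mul_inv, ENNReal.mul_inv]
          · have hk : (0 : ℝ) < 2 ^ k := by positivity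
            simp only [ha]
            gcongr
          · left; simpa using Real.rpow_pos_of_pos hd _
          · left; simp
      _ = ∑' k : ℤ, (∫⁻ x in ball y (2 ^ (k + 1)), ‖u x - u y‖ₑ ^ p ∂m) *
            (a k * (m (ball y (2 ^ k)))⁻¹) := by
          rw [lintegral_tsum fun k =>
            ((hfm.mul_const _).indicator measurableSet_ball).aemeasurable]
          refine tsum_congr fun k => ?_
          rw [lintegral_indicator measurableSet_ball, lintegral_mul_const _ hfm]
      _ ≤ _ := by
          refine ENNReal.tsum_le_tsum fun k => ?_
          have hk : (0 : ℝ) < 2 ^ k := by positivity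
          have e : (2 : ℝ) ^ (k + 1) = 2 * 2 ^ k := by rw [zpow_add_one₀ two_ne_zero]; ring
          have h1 := hK y y _ hk (by simpa using hk.le)
          rw [← e] at h1
          rw [ballOsc, setLAverage_eq, div_eq_mul_inv]
          calc _ ≤ (∫⁻ x in ball y (2 ^ (k + 1)), ‖u x - u y‖ₑ ^ p ∂m) *
                (a k * (K * (m (ball y (2 ^ (k + 1))))⁻¹)) := by
                gcongr
                exact ENNReal.inv_le_mul_inv_of_le_mul (hb0 _ (by positivity)) (hb1 _) h1
            _ = _ := by ring
  refine (lintegral_mono point).trans_lt ?_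
  rw [lintegral_tsum fun k => (((hosc _).const_mul _).const_mul _).aemeasurable]
  have e : ∀ k : ℤ, ∫⁻ y, K * (a k * ballOsc p m u (2 ^ (k + 1)) y) ∂m
      = K * (a k * ballEnergy p m u (2 ^ (k + 1))) := fun k => by
    rw [lintegral_const_mul _ ((hosc _).const_mul _), lintegral_const_mul _ (hosc _)]; rfl
  simp_rw [e]
  rw [ENNReal.tsum_mul_left]
  exact ENNReal.mul_lt_top (by simp) hlt

end BesovSpaces

/-! ### Weak compactness in reflexive spaces. -/

section Reflexive

open Filter Topology

/-- In a reflexive space, the closure of a convex set `K` contains every point that is approximated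
by a bounded sequence in `K` in a weaker norm. -/
theorem mem_closure_of_reflexive {V W : Type*} [NormedAddCommGroup V] [NormedSpace ℝ V]
    [NormedAddCommGroup W] [NormedSpace ℝ W]
    (hV : Function.Surjective (NormedSpace.inclusionInDoubleDual ℝ V))
    (T : V →L[ℝ] W) (hT : Function.Injective T) {K : Set V} (hK : Convex ℝ K) {v : V}
    {w : ℕ → V} (hw : ∀ n, w n ∈ K) {M : ℝ} (hM : ∀ n, ‖w n‖ ≤ M)
    (hlim : Tendsto (fun n => T (w n)) atTop (𝓝 (T v))) : v ∈ closure K := by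
  by_contra hv
  obtain ⟨f, s, hfv, hfK⟩ := geometric_hahn_banach_point_closed hK.closure isClosed_closure hv
  -- An ultrafilter limit replaces a weakly convergent subsequence: Banach–Alaoglu in the bidual
  -- provides a limit `Φ`, and reflexivity represents it by some `z` in `V`.
  let U : Ultrafilter ℕ := hyperfilter ℕ
  let J : V → WeakDual ℝ (StrongDual ℝ V) := fun x =>
    StrongDual.toWeakDual (NormedSpace.inclusionInDoubleDual ℝ V x)
  have hcpt := WeakDual.isCompact_closedBall (𝕜 := ℝ) (E := StrongDual ℝ V) 0 M
  have hmem : ∀ n, J (w n) ∈ WeakDual.toStrongDual ⁻¹' Metric.closedBall (0 : StrongDual ℝ _) M :=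
    fun n => by
      refine (mem_closedBall_zero_iff (E := StrongDual ℝ (StrongDual ℝ V))).2 ?_
      exact (NormedSpace.double_dual_bound ℝ V (w n)).trans (hM n)
  obtain ⟨Φ, -, hΦ⟩ := hcpt.ultrafilter_le_nhds (U.map fun n => J (w n))
    (by
      rw [le_principal_iff]
      exact Filter.mem_map.2 (Filter.univ_mem' hmem))
  obtain ⟨z, hz⟩ := hV (WeakDual.toStrongDual Φ)
  have hzΦ : ∀ g : StrongDual ℝ V, Φ g = g z := fun g => by
    have := congrArg (fun L => L g) hz
    exact this.symm
  have hconv : ∀ g : StrongDual ℝ V, Tendsto (fun n => g (w n)) U (𝓝 (g z)) := fun g => by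
    have h1 : Tendsto (fun n => J (w n)) U (𝓝 Φ) := hΦ
    have h2 := ((WeakDual.eval_continuous g).tendsto Φ).comp h1
    rw [hzΦ] at h2
    exact h2
  have hU : (U : Filter ℕ) ≤ atTop := Nat.hyperfilter_le_atTop
  -- The weak limit of `T (w n)` is `T z`, its norm limit is `T v`; injectivity of `T` gives `z =
  -- v`, against the separation of `v` from `K`.
  have hTz : T z = T v := by
    refine (SeparatingDual.eq_iff_forall_dual_eq (R := ℝ)).2 fun h => ?_
    have h1 := hconv (h.comp T)
    have h2 : Tendsto (fun n => h (T (w n))) U (𝓝 (h (T v))) :=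
      (h.continuous.tendsto _).comp (hlim.mono_left hU)
    exact tendsto_nhds_unique h1 h2
  have hzv : z = v := hT hTz
  have h3 : s ≤ f z := ge_of_tendsto (hconv f)
    (Eventually.of_forall fun n => (hfK _ (subset_closure (hw n))).le)
  rw [hzv] at h3
  linarith

end Reflexive

/-! ### Continuous compactly supported functions of the domain and their energy bounds. -/

section Core

variable {X : Type*} [MeasurableSpace X] {p : ℝ} [hp : Fact (1 < p)] {m : Measure X}

namespace PEnergyForm

theorem energy_nonneg (𝓔 : PEnergyForm p m) (u : 𝓔.domain) : 0 ≤ 𝓔.energy u :=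
  𝓔.isPEnergyForm.1 u

/-- The seminorm `E ^ (1 / p)`. -/
noncomputable def seminorm (𝓔 : PEnergyForm p m) : Seminorm ℝ 𝓔.domain :=
  𝓔.isPEnergyForm.2.choose

theorem seminorm_apply (𝓔 : PEnergyForm p m) (u : 𝓔.domain) :
    𝓔.seminorm u = 𝓔.energy u ^ (1 / p) :=
  𝓔.isPEnergyForm.2.choose_spec u

theorem seminorm_le_of_energy_le (𝓔 : PEnergyForm p m) {u : 𝓔.domain} {e : ℝ}
    (h : 𝓔.energy u ≤ e) : 𝓔.seminorm u ≤ e ^ (1 / p) := by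
  have := hp.out
  rw [seminorm_apply]
  exact Real.rpow_le_rpow (𝓔.energy_nonneg u) h (by positivity)

theorem energy_eq_rpow (𝓔 : PEnergyForm p m) (u : 𝓔.domain) :
    𝓔.energy u = 𝓔.seminorm u ^ p := by
  have := hp.out
  rw [seminorm_apply, ← Real.rpow_mul (𝓔.energy_nonneg u), one_div,
    inv_mul_cancel₀ (by linarith), Real.rpow_one]

/-- The inclusion of the Banach space `F` into `Lᵖ`. -/
noncomputable def Space.toLp (𝓔 : PEnergyForm p m) : 𝓔.Space →L[ℝ] Lp ℝ (ENNReal.ofReal p) m :=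
  LinearMap.mkContinuous
    { toFun := fun u => (u.toDomain : Lp ℝ (ENNReal.ofReal p) m)
      map_add' := fun _ _ => rfl
      map_smul' := fun _ _ => rfl } 1 fun u => by
    rw [one_mul, Space.norm_def]
    exact le_add_of_nonneg_right (Real.rpow_nonneg (𝓔.energy_nonneg _) _)

variable [TopologicalSpace X]

/-- `f ∈ C_c(X)` represents an element of the domain whose `E ^ (1 / p)` is at most `t`. -/
def CoreBound (𝓔 : PEnergyForm p m) (f : X → ℝ) (t : ℝ) : Prop :=
  Continuous f ∧ HasCompactSupport f ∧
    ∃ w : 𝓔.domain, (w : Lp ℝ (ENNReal.ofReal p) m) =ᵐ[m] f ∧ 𝓔.seminorm w ≤ t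

namespace CoreBound

variable {𝓔 : PEnergyForm p m} {f g : X → ℝ} {s t : ℝ}

theorem mono (hf : 𝓔.CoreBound f s) (h : s ≤ t) : 𝓔.CoreBound f t := by
  obtain ⟨h1, h2, w, h3, h4⟩ := hf
  exact ⟨h1, h2, w, h3, h4.trans h⟩

theorem zero : 𝓔.CoreBound (fun _ => 0) 0 :=
  ⟨continuous_const, HasCompactSupport.zero, 0, Lp.coeFn_zero _ _ _, by simp⟩

theorem add (hf : 𝓔.CoreBound f s) (hg : 𝓔.CoreBound g t) :
    𝓔.CoreBound (fun x => f x + g x) (s + t) := by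
  obtain ⟨h1, h2, w, h3, h4⟩ := hf
  obtain ⟨k1, k2, v, k3, k4⟩ := hg
  refine ⟨h1.add k1, h2.add k2, w + v, ?_, (map_add_le_add _ _ _).trans (add_le_add h4 k4)⟩
  filter_upwards [Lp.coeFn_add (w : Lp ℝ (ENNReal.ofReal p) m) v, h3, k3] with x e1 e2 e3
  rw [Submodule.coe_add, e1, Pi.add_apply, e2, e3]

theorem const_mul (hf : 𝓔.CoreBound f s) (a : ℝ) :
    𝓔.CoreBound (fun x => a * f x) (|a| * s) := by
  obtain ⟨h1, h2, w, h3, h4⟩ := hf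
  refine ⟨h1.const_mul a, h2.mul_left, a • w, ?_, ?_⟩
  · filter_upwards [Lp.coeFn_smul a (w : Lp ℝ (ENNReal.ofReal p) m), h3] with x e1 e2
    rw [Submodule.coe_smul, e1, Pi.smul_apply, e2, smul_eq_mul]
  · rw [map_smul_eq_mul, Real.norm_eq_abs]
    gcongr

theorem neg (hf : 𝓔.CoreBound f s) : 𝓔.CoreBound (fun x => -f x) s := by
  simpa using hf.const_mul (-1)

theorem sub (hf : 𝓔.CoreBound f s) (hg : 𝓔.CoreBound g t) :
    𝓔.CoreBound (fun x => f x - g x) (s + t) := by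
  simpa [sub_eq_add_neg] using hf.add hg.neg

theorem finset_sum {ι : Type*} {S : Finset ι} {f : ι → X → ℝ} {t : ι → ℝ}
    (h : ∀ i ∈ S, 𝓔.CoreBound (f i) (t i)) :
    𝓔.CoreBound (fun x => ∑ i ∈ S, f i x) (∑ i ∈ S, t i) := by
  classical
  induction S using Finset.induction_on with
  | empty => simpa using CoreBound.zero
  | insert a S ha ih =>
    simp only [Finset.sum_insert ha]
    exact (h a (Finset.mem_insert_self a S)).add
      (ih fun i hi => h i (Finset.mem_insert_of_mem hi))

end CoreBound

end PEnergyForm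

end Core

/-- Truncating between two barriers `a ≤ b` does not change a clamped cutoff function, provided that
the barriers are trivial off the sets where it is prescribed. -/
theorem max_min_clamp_eq {X : Type*} {E₁ E₀ : Set X} {x : X} {a b s : ℝ} (ha : 0 ≤ a)
    (hab : a ≤ b) (hb : b ≤ 1) (hE₁ : x ∉ E₁ → a = 0) (hE₀ : x ∉ E₀ → b = 1)
    (h₁ : x ∈ E₁ → s = 1) (h₀ : x ∈ E₀ → s = 0) :
    max (min (max 0 (min s 1)) b) a = max 0 (min s 1) := by
  by_cases hx₁ : x ∈ E₁ <;> by_cases hx₀ : x ∈ E₀ <;> grind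

/-! ### Lattice operations, density of the domain, cutoffs in the core. -/

section Framework

variable {X : Type*} [MetricSpace X] [MeasurableSpace X] {p : ℝ} [hp : Fact (1 < p)]
  {m : Measure X} {𝓔 : PEnergyForm p m} {Γ : 𝓔.domain → Measure X}

namespace IsEnergyFramework

open PEnergyForm

variable {f g : X → ℝ} {s t : ℝ}

theorem exists_contraction (h : IsEnergyFramework 𝓔 Γ) (u : 𝓔.domain) {φ : ℝ → ℝ}
    (hφ : LipschitzWith 1 φ) (h0 : φ 0 = 0) :
    ∃ w : 𝓔.domain, (w : Lp ℝ (ENNReal.ofReal p) m) =ᵐ[m] (fun x =>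
      φ ((u : Lp ℝ (ENNReal.ofReal p) m) x)) ∧ 𝓔.seminorm w ≤ 𝓔.seminorm u := by
  obtain ⟨hm, hle⟩ := h.lipschitz_contraction u φ hφ h0
  refine ⟨⟨_, hm⟩, hφ.coeFn_compLp h0 _, ?_⟩
  rw [𝓔.seminorm_apply u]
  exact 𝓔.seminorm_le_of_energy_le hle

theorem coreBound_comp (h : IsEnergyFramework 𝓔 Γ) (hf : 𝓔.CoreBound f s) {φ : ℝ → ℝ}
    (hφ : LipschitzWith 1 φ) (h0 : φ 0 = 0) : 𝓔.CoreBound (fun x => φ (f x)) s := by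
  obtain ⟨h1, h2, w, h3, h4⟩ := hf
  obtain ⟨v, hv, hle⟩ := h.exists_contraction w hφ h0
  refine ⟨hφ.continuous.comp h1, h2.comp_left h0, v, ?_, hle.trans h4⟩
  filter_upwards [hv, h3] with x e1 e2
  rw [e1, e2]

theorem coreBound_abs (h : IsEnergyFramework 𝓔 Γ) (hf : 𝓔.CoreBound f s) :
    𝓔.CoreBound (fun x => |f x|) s :=
  h.coreBound_comp hf (φ := fun x => |x|)
    (LipschitzWith.mk_one fun a b => abs_abs_sub_abs_le a b) abs_zero

/-- The maximum is `(f + g + |f - g|)/2`, and the absolute value is a contraction. -/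
theorem coreBound_max (h : IsEnergyFramework 𝓔 Γ) (hf : 𝓔.CoreBound f s)
    (hg : 𝓔.CoreBound g t) : 𝓔.CoreBound (fun x => max (f x) (g x)) (s + t) := by
  convert ((hf.add hg).add (h.coreBound_abs (hf.sub hg))).const_mul 2⁻¹ using 1
  · ext x
    rcases le_total (f x) (g x) with hx | hx
    · rw [max_eq_right hx, abs_of_nonpos (by linarith)]; ring
    · rw [max_eq_left hx, abs_of_nonneg (by linarith)]; ring
  · rw [abs_of_pos (by norm_num)]; ring

theorem coreBound_min (h : IsEnergyFramework 𝓔 Γ) (hf : 𝓔.CoreBound f s)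
    (hg : 𝓔.CoreBound g t) : 𝓔.CoreBound (fun x => min (f x) (g x)) (s + t) := by
  simpa [max_neg_neg] using (h.coreBound_max hf.neg hg.neg).neg

theorem coreBound_fold_max (h : IsEnergyFramework 𝓔 Γ) {ι : Type*} {S : Finset ι}
    {f : ι → X → ℝ} {t : ι → ℝ} (hf : ∀ i ∈ S, 𝓔.CoreBound (f i) (t i)) :
    𝓔.CoreBound (fun x => S.fold max 0 fun i => f i x) (∑ i ∈ S, t i) := by
  classical
  induction S using Finset.induction_on with
  | empty => simpa using CoreBound.zero
  | insert a S ha ih =>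
    simp only [Finset.sum_insert ha, Finset.fold_insert ha]
    exact h.coreBound_max (hf a (Finset.mem_insert_self a S))
      (ih fun i hi => hf i (Finset.mem_insert_of_mem hi))

/-- Urysohn functions in the core. -/
theorem exists_urysohn [LocallyCompactSpace X] (h : IsEnergyFramework 𝓔 Γ) {K U : Set X}
    (hK : IsCompact K) (hU : IsOpen U) (hKU : K ⊆ U) :
    ∃ (χ : X → ℝ) (t : ℝ), 𝓔.CoreBound χ t ∧ (∀ x ∈ K, χ x = 1) ∧ (∀ x ∉ U, χ x = 0) ∧
      ∀ x, 0 ≤ χ x ∧ χ x ≤ 1 := by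
  obtain ⟨g, hg1, hg0, hgc, -⟩ := exists_continuous_one_zero_of_isCompact hK hU.isClosed_compl
    (disjoint_compl_right_iff_subset.2 hKU)
  obtain ⟨u, f, hf, hfc, huf, hfg⟩ := h.uniformly_dense g g.continuous hgc (1 / 4) (by norm_num)
  -- Since `f` is within `1/4` of `g`, it exceeds `3/4` on `K`, where `φ` is `1/2`, and is below
  -- `1/4` off `U`, where `φ` vanishes. Doubling gives the values `1` and `0`.
  let φ : ℝ → ℝ := fun t => max 0 (min (t - 1 / 4) (1 / 2))
  have hφ : LipschitzWith 1 φ :=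
    ((LipschitzWith.id.sub (LipschitzWith.const (1 / 4 : ℝ))).min_const _).const_max _ |>.weaken
      (by simp)
  refine ⟨fun x => 2 * φ (f x), _, (h.coreBound_comp ⟨hf, hfc, u, huf, le_rfl⟩ hφ
    (by norm_num [φ])).const_mul 2, fun x hx => ?_, fun x hx => ?_, fun x => ⟨?_, ?_⟩⟩
  · have h1 := hfg x
    rw [hg1 hx, abs_lt] at h1
    simp only [Pi.one_apply] at h1
    simp only [φ]
    rw [min_eq_right (by linarith), max_eq_right (by norm_num)]
    norm_num
  · have h1 := hfg x
    rw [hg0 hx, abs_lt] at h1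
    simp only [Pi.zero_apply] at h1
    simp only [φ]
    rw [max_eq_left ((min_le_left _ _).trans (by linarith))]
    norm_num
  · have : 0 ≤ φ (f x) := le_max_left _ _
    linarith
  · have : φ (f x) ≤ 1 / 2 := max_le (by norm_num) (min_le_right _ _)
    linarith

/-- The domain is dense in `Lᵖ`. -/
theorem dense_domain [LocallyCompactSpace X] [BorelSpace X] [m.Regular]
    (h : IsEnergyFramework 𝓔 Γ) : Dense (𝓔.domain : Set (Lp ℝ (ENNReal.ofReal p) m)) := by
  intro u
  refine Metric.mem_closure_iff.2 fun ε hε => ?_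
  have hε2 : ENNReal.ofReal (ε / 2) ≠ 0 := by simpa using hε
  have hε4 : ENNReal.ofReal (ε / 2 / 2) ≠ 0 := by simpa using hε
  obtain ⟨g, hgc, hug, hg, hgL⟩ := (Lp.memLp u).exists_hasCompactSupport_eLpNorm_sub_le
    ENNReal.ofReal_ne_top hε4
  set M : ℝ≥0∞ := m (tsupport g) ^ (1 / (ENNReal.ofReal p).toReal) with hM
  have hMtop : M ≠ ∞ := ENNReal.rpow_ne_top_of_nonneg (by positivity) hgc.measure_lt_top.ne
  obtain ⟨δ, hδ, hδM⟩ : ∃ δ : ℝ, 0 < δ ∧ ENNReal.ofReal (2 * δ) * M < ENNReal.ofReal (ε / 2) := by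
    obtain ⟨c, hc, hcM⟩ := ENNReal.exists_nnreal_pos_mul_lt hMtop hε2
    refine ⟨c / 2, by positivity, ?_⟩
    rwa [mul_div_cancel₀ _ two_ne_zero, ENNReal.ofReal_coe_nnreal]
  obtain ⟨w, f, hf, hfc, hwf, hfg⟩ := h.uniformly_dense g hg hgc δ hδ
  -- Soft thresholding: the support of `f` depends on `δ` with no bound on its measure, but `|f| <
  -- δ` off the support of `g`, so `φ ∘ f` vanishes there and differs from `g` by at most `2δ` on a
  -- fixed set of finite measure.
  let φ : ℝ → ℝ := fun t => max (t - δ) 0 + min (t + δ) 0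
  have hφ : LipschitzWith 1 φ := LipschitzWith.mk_one fun a b => by
    simp only [φ, Real.dist_eq]
    grind
  have hφ0 : φ 0 = 0 := by simp [φ, hδ.le]
  have hφδ : ∀ t, |φ t - t| ≤ δ := fun t => by simp only [φ]; grind
  have hφz : ∀ t, |t| < δ → φ t = 0 := fun t ht => by simp only [φ]; grind
  obtain ⟨v, hv, -⟩ := h.exists_contraction w hφ hφ0
  refine ⟨v, v.2, ?_⟩
  rw [← edist_lt_ofReal, Lp.edist_def]
  have e : (u : X → ℝ) - ((v : Lp ℝ (ENNReal.ofReal p) m) : X → ℝ) =ᵐ[m]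
      ((u : X → ℝ) - g) + (tsupport g).indicator (g - fun x => φ (f x)) := by
    filter_upwards [hv, hwf] with x h1 h2
    simp only [Pi.sub_apply, Pi.add_apply, h1, h2]
    by_cases hx : x ∈ tsupport g
    · rw [indicator_of_mem hx, Pi.sub_apply]
      ring
    · rw [indicator_of_notMem hx]
      have hgx : g x = 0 := image_eq_zero_of_notMem_tsupport hx
      have h3 := hfg x
      rw [hgx, sub_zero] at h3
      rw [hφz _ h3, hgx]
      ring
  rw [eLpNorm_congr_ae e]
  have hmeas : AEStronglyMeasurable ((tsupport g).indicator (g - fun x => φ (f x))) m :=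
    ((hg.sub (hφ.continuous.comp hf)).aestronglyMeasurable).indicator
      (isClosed_tsupport g).measurableSet
  refine (eLpNorm_add_le ((Lp.aestronglyMeasurable u).sub hg.aestronglyMeasurable) hmeas
    (ENNReal.one_le_ofReal.2 hp.out.le)).trans_lt ?_
  have h2 : eLpNorm ((tsupport g).indicator (g - fun x => φ (f x))) (ENNReal.ofReal p) m
      < ENNReal.ofReal (ε / 2) := by
    refine (eLpNorm_indicator_sub_le_of_dist_bdd m ENNReal.ofReal_ne_top
      (isClosed_tsupport g).measurableSet (c := 2 * δ) (by positivity) fun x _ => ?_).trans_lt hδM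
    have h3 := hfg x
    have h4 := hφδ (f x)
    rw [Real.dist_eq]
    grind
  calc _ < ENNReal.ofReal (ε / 2 / 2) + ENNReal.ofReal (ε / 2) :=
        ENNReal.add_lt_add_of_le_of_lt (ne_top_of_le_ne_top ENNReal.ofReal_ne_top hug) hug h2
    _ ≤ ENNReal.ofReal ε := by
        rw [← ENNReal.ofReal_add (by positivity) (by positivity)]
        exact ENNReal.ofReal_le_ofReal (by linarith)

/-- A cutoff function of the domain can be replaced by one in the core, at the cost of an
arbitrarily small increase of the energy. -/
theorem exists_core_cutoff (h : IsEnergyFramework 𝓔 Γ) {E₁ E₀ : Set X} {ψ : 𝓔.domain}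
    (hψ : ψ ∈ cutoffFunctions 𝓔 E₁ E₀) {χ₁ χ₂ : X → ℝ} {t₁ t₂ : ℝ}
    (h₁ : 𝓔.CoreBound χ₁ t₁) (h₂ : 𝓔.CoreBound χ₂ t₂) (h01 : ∀ x, 0 ≤ χ₁ x)
    (h12 : ∀ x, χ₁ x ≤ χ₂ x) (h21 : ∀ x, χ₂ x ≤ 1) (hE₁ : ∀ x ∉ E₁, χ₁ x = 0)
    (hE₀ : ∀ x ∉ E₀, χ₂ x = 1) (ht : 𝓔.seminorm ψ < t) :
    ∃ f, 𝓔.CoreBound f t ∧ ∀ x, χ₁ x ≤ f x ∧ f x ≤ χ₂ x := by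
  let c : ℝ → ℝ := fun s => max 0 (min s 1)
  have hc : LipschitzWith 1 c := (LipschitzWith.id.min_const 1).const_max 0
  obtain ⟨ψ', hψ', hle⟩ := h.exists_contraction ψ hc (by simp [c])
  let v : 𝓔.Space := ψ'
  -- The goal becomes that the clamped cutoff `v` lies in the closure of this convex set of core
  -- functions between the barriers.
  let K : Set 𝓔.Space := {w | ∃ f : X → ℝ, Continuous f ∧ HasCompactSupport f ∧
    (w.toDomain : Lp ℝ (ENNReal.ofReal p) m) =ᵐ[m] f ∧ ∀ x, χ₁ x ≤ f x ∧ f x ≤ χ₂ x}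
  have hnorm : ∀ w : 𝓔.Space, ‖w‖ = ‖Space.toLp 𝓔 w‖ + 𝓔.seminorm w.toDomain := fun w => by
    rw [Space.norm_def, 𝓔.seminorm_apply]; rfl
  have hlp : ∀ w : 𝓔.Space, ‖Space.toLp 𝓔 w‖ ≤ ‖w‖ := fun w => by
    rw [hnorm]; exact le_add_of_nonneg_right (apply_nonneg _ _)
  have hsn : ∀ w : 𝓔.Space, 𝓔.seminorm w.toDomain ≤ ‖w‖ := fun w => by
    rw [hnorm]; exact le_add_of_nonneg_left (norm_nonneg _)
  have hK : Convex ℝ K := by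
    rintro w ⟨f, hf1, hf2, hf3, hf4⟩ w' ⟨g, hg1, hg2, hg3, hg4⟩ a b ha hb hab
    refine ⟨fun x => a * f x + b * g x, (hf1.const_mul a).add (hg1.const_mul b),
      hf2.mul_left.add hg2.mul_left, ?_, fun x => ?_⟩
    · have e : ((a • w + b • w').toDomain : Lp ℝ (ENNReal.ofReal p) m)
        = a • (w.toDomain : Lp ℝ (ENNReal.ofReal p) m) + b • (w'.toDomain : Lp ℝ _ m) := rfl
      rw [e]
      filter_upwards [hf3, hg3, Lp.coeFn_smul a (w.toDomain : Lp ℝ (ENNReal.ofReal p) m),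
        Lp.coeFn_smul b (w'.toDomain : Lp ℝ (ENNReal.ofReal p) m),
        Lp.coeFn_add (a • (w.toDomain : Lp ℝ (ENNReal.ofReal p) m))
          (b • (w'.toDomain : Lp ℝ (ENNReal.ofReal p) m))] with x e1 e2 e3 e4 e5
      rw [e5, Pi.add_apply, e3, e4, Pi.smul_apply, Pi.smul_apply, e1, e2, smul_eq_mul,
        smul_eq_mul]
    · have e := fun s : ℝ => (by rw [← add_mul, hab, one_mul] : a * s + b * s = s)
      have := hf4 x
      have := hg4 x
      constructor
      · rw [← e (χ₁ x)]; nlinarith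
      · rw [← e (χ₂ x)]; nlinarith
  -- Truncating core approximants of `v` by `χ₂` and `χ₁` keeps `Lᵖ` convergence, because truncation
  -- is pointwise `1`-Lipschitz and fixes `v`. The energies are only shown bounded, so convergence
  -- in the domain is not immediate; reflexivity supplies the rest.
  have happ : ∀ n : ℕ, ∃ w ∈ K, ‖Space.toLp 𝓔 w - Space.toLp 𝓔 v‖ ≤ 1 / ((n : ℝ) + 1) ∧
      𝓔.seminorm w.toDomain ≤ ‖v‖ + 1 + t₂ + t₁ := by
    intro n
    obtain ⟨w, ⟨f, hf1, hf2, hf3⟩, hw⟩ := Metric.mem_closure_iff.1 (h.dense_core v)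
      (1 / ((n : ℝ) + 1)) (by positivity)
    rw [dist_eq_norm, norm_sub_rev] at hw
    have hn1 : 1 / ((n : ℝ) + 1) ≤ 1 := by
      rw [div_le_one (by positivity)]; linarith [n.cast_nonneg (α := ℝ)]
    obtain ⟨k1, k2, w', k3, k4⟩ := h.coreBound_max
      (h.coreBound_min (𝓔 := 𝓔) ⟨hf1, hf2, w.toDomain, hf3, le_rfl⟩ h₂) h₁
    let w'' : 𝓔.Space := w'
    refine ⟨w'', ⟨_, k1, k2, k3, fun x => ⟨le_max_right _ _, max_le (min_le_right _ _) (h12 x)⟩⟩,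
      ?_, k4.trans ?_⟩
    · refine le_trans ?_ ((hlp (w - v)).trans hw.le)
      rw [map_sub]
      refine Lp.norm_le_norm_of_ae_le ?_
      have k3' : (Space.toLp 𝓔 w'' : X → ℝ) =ᵐ[m] _ := k3
      have hf3' : (Space.toLp 𝓔 w : X → ℝ) =ᵐ[m] f := hf3
      have hψ'' : (Space.toLp 𝓔 v : X → ℝ) =ᵐ[m] _ := hψ'
      filter_upwards [Lp.coeFn_sub (Space.toLp 𝓔 w'') (Space.toLp 𝓔 v),
        Lp.coeFn_sub (Space.toLp 𝓔 w) (Space.toLp 𝓔 v), k3', hf3', hψ'', hψ.1, hψ.2]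
        with x e1 e2 e3 e4 e5 e6 e7
      rw [e1, e2, Pi.sub_apply, Pi.sub_apply, e3, e4, e5, Real.norm_eq_abs, Real.norm_eq_abs]
      have hfix := max_min_clamp_eq (h01 x) (h12 x) (h21 x) (hE₁ x) (hE₀ x) e6 e7
      calc _ = |max (min (f x) (χ₂ x)) (χ₁ x) - max (min (c ((ψ : Lp ℝ (ENNReal.ofReal p) m) x))
            (χ₂ x)) (χ₁ x)| := by rw [hfix]
        _ ≤ _ := ?_
      grind
    · have h3 := hsn w
      have h4 := norm_le_norm_add_norm_sub' w v
      linarith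
  choose w hwK hw1 hw2 using happ
  have hcl : v ∈ closure K := by
    refine mem_closure_of_reflexive h.reflexive (Space.toLp 𝓔) (fun a b hab => ?_) hK hwK
      (M := ‖v‖ + 1 + (‖v‖ + 1 + t₂ + t₁)) (fun n => ?_) ?_
    · exact Subtype.ext hab
    · have h3 := hlp v
      have h4 := norm_le_norm_add_norm_sub' (Space.toLp 𝓔 (w n)) (Space.toLp 𝓔 v)
      have hn1 : 1 / ((n : ℝ) + 1) ≤ 1 := by
        rw [div_le_one (by positivity)]; linarith [n.cast_nonneg (α := ℝ)]
      have := hw1 n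
      have := hw2 n
      rw [hnorm]
      linarith
    · exact tendsto_iff_norm_sub_tendsto_zero.2 (squeeze_zero (fun _ => norm_nonneg _) hw1
        tendsto_one_div_add_atTop_nhds_zero_nat)
  obtain ⟨z, ⟨f, hf1, hf2, hf3, hf4⟩, hz⟩ := Metric.mem_closure_iff.1 hcl _ (sub_pos.2 ht)
  refine ⟨f, ⟨hf1, hf2, z.toDomain, hf3, ?_⟩, hf4⟩
  rw [dist_eq_norm, norm_sub_rev] at hz
  have h3 : 𝓔.seminorm z.toDomain ≤ 𝓔.seminorm v.toDomain + 𝓔.seminorm (z - v).toDomain := by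
    have e : z.toDomain = v.toDomain + (z - v).toDomain := by
      change z = v + (z - v)
      abel
    rw [e]
    exact map_add_le_add _ _ _
  have h4 := hsn (z - v)
  have h5 : 𝓔.seminorm v.toDomain ≤ 𝓔.seminorm ψ := hle
  linarith

end IsEnergyFramework

end Framework

/-! ### The Poincaré inequality bounds Besov energies by the energy form. -/

section LowerBound

open Metric

variable {X : Type*} [MetricSpace X] [MeasurableSpace X] {m : Measure X} {p : ℝ}

theorem measure_univ_le_of_forall_ball {μ : Measure X} {C : ℝ≥0∞} (x₀ : X)
    (h : ∀ n : ℕ, μ (ball x₀ n) ≤ C) : μ univ ≤ C := by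
  rw [← iUnion_ball_nat x₀, Directed.measure_iUnion]
  · exact iSup_le h
  · exact directed_of_isDirected_le fun a b hab => ball_subset_ball (by exact_mod_cast hab)

theorem IsEnergyFramework.measure_univ_eq [Fact (1 < p)] {𝓔 : PEnergyForm p m}
    {Γ : 𝓔.domain → Measure X} (h : IsEnergyFramework 𝓔 Γ) (u : 𝓔.domain) :
    Γ u univ = ENNReal.ofReal (𝓔.energy u) := by
  have := h.finite_measure u
  rw [h.energy_eq, ofReal_measureReal]

theorem PoincareInequality.exists_enorm [hp : Fact (1 < p)] {𝓔 : PEnergyForm p m}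
    {Γ : 𝓔.domain → Measure X} {β : ℝ} (h : PoincareInequality 𝓔 Γ fun r => r ^ β) :
    ∃ (C : ℝ≥0) (A : ℝ), 1 ≤ A ∧ ∀ (x : X) (r : ℝ), 0 < r → ∀ u : 𝓔.domain, ∃ c : ℝ,
      ∫⁻ y in ball x r, ‖(u : Lp ℝ (ENNReal.ofReal p) m) y - c‖ₑ ^ p ∂m
        ≤ C * ENNReal.ofReal (r ^ β) * Γ u (ball x (A * r)) := by
  obtain ⟨C, A, hC, hA, h⟩ := h
  refine ⟨C.toNNReal, A, hA, fun x r hr u =>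
    ⟨⨍ z in ball x r, (u : Lp ℝ (ENNReal.ofReal p) m) z ∂m, ?_⟩⟩
  have := h x r hr u
  simp only [ofReal_abs_rpow (zero_lt_one.trans hp.out).le, ENNReal.ofReal_mul hC.le] at this
  exact this

variable [BorelSpace X] [IsLocallyFiniteMeasure m] [m.IsOpenPosMeasure]

/-- Both `u x` and `u y` are compared with `c`, and averages over `B(y,r)` are bounded by averages
over `B(x,2r)`. -/
theorem VolumeDoubling.setLIntegral_ballOsc_le (h : VolumeDoubling m) (hp : 1 < p) :
    ∃ K : ℝ≥0, ∀ u : X → ℝ, Measurable u → ∀ (c : ℝ) (x : X) (r : ℝ), 0 < r →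
      ∫⁻ y in ball x r, ballOsc p m u r y ∂m ≤ K * ∫⁻ y in ball x (2 * r), ‖u y - c‖ₑ ^ p ∂m := by
  obtain ⟨K, -, hK⟩ := h.comparable 2
  refine ⟨2 ^ (p - 1) * (K + 1), fun u hu c x r hr => ?_⟩
  have h2 : (2 : ℝ≥0∞) ^ (p - 1) ≠ ∞ :=
    (ENNReal.rpow_lt_top_of_nonneg (by linarith) (by simp)).ne
  have hf : Measurable fun y => ‖u y - c‖ₑ ^ p := ((hu.sub_const c).enorm).pow_const p
  set I := ∫⁻ y in ball x (2 * r), ‖u y - c‖ₑ ^ p ∂m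
  have hb0 : m (ball x (2 * r)) ≠ 0 := (measure_ball_pos m x (by positivity)).ne'
  have hb1 : m (ball x (2 * r)) ≠ ∞ := (h.measure_ball_lt_top x _).ne
  have hpt : ∀ y ∈ ball x r, ballOsc p m u r y
      ≤ 2 ^ (p - 1) * (I * (K * (m (ball x (2 * r)))⁻¹) + ‖u y - c‖ₑ ^ p) := by
    intro y hy
    have hxy : dist x y < r := by rw [dist_comm]; exact hy
    have hsub : ball y r ⊆ ball x (2 * r) := ball_subset_ball' (by
      have : dist y x < r := hy
      linarith)
    have h3 : (⨍⁻ _ in ball y r, ‖u y - c‖ₑ ^ p ∂m) = ‖u y - c‖ₑ ^ p :=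
      setLAverage_const (measure_ball_pos m y hr).ne' (h.measure_ball_lt_top y r).ne _
    have h4 : ⨍⁻ z in ball y r, ‖u z - c‖ₑ ^ p ∂m ≤ I * (K * (m (ball x (2 * r)))⁻¹) := by
      rw [setLAverage_eq, div_eq_mul_inv]
      exact mul_le_mul' (lintegral_mono_set hsub)
        (ENNReal.inv_le_mul_inv_of_le_mul hb0 hb1 (hK x y r hr (by linarith)))
    calc ballOsc p m u r y
        ≤ 2 ^ (p - 1) * ((⨍⁻ z in ball y r, ‖u z - c‖ₑ ^ p ∂m) + ‖u y - c‖ₑ ^ p) := by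
          rw [← h3]
          simp only [ballOsc, laverage_eq']
          rw [← lintegral_add_left hf, ← lintegral_const_mul' _ _ h2]
          refine lintegral_mono fun z => ?_
          have := enorm_sub_rpow_le hp.le (u z - c) (u y - c)
          rwa [sub_sub_sub_cancel_right] at this
      _ ≤ _ := by gcongr
  calc ∫⁻ y in ball x r, ballOsc p m u r y ∂m
      ≤ ∫⁻ y in ball x r, 2 ^ (p - 1) * (I * (K * (m (ball x (2 * r)))⁻¹) + ‖u y - c‖ₑ ^ p) ∂m :=
        setLIntegral_mono' measurableSet_ball hpt
    _ = 2 ^ (p - 1) * (I * (K * (m (ball x (2 * r)))⁻¹) * m (ball x r)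
          + ∫⁻ y in ball x r, ‖u y - c‖ₑ ^ p ∂m) := by
        rw [lintegral_const_mul' _ _ h2, lintegral_add_right _ hf, setLIntegral_const]
    _ ≤ 2 ^ (p - 1) * (I * (K * (m (ball x (2 * r)))⁻¹) * m (ball x (2 * r)) + I) := by
        gcongr
        · linarith
        · exact lintegral_mono_set (ball_subset_ball (by linarith))
    _ = 2 ^ (p - 1) * (K + 1) * I := by
        rw [mul_assoc I, mul_assoc (K : ℝ≥0∞), ENNReal.inv_mul_cancel hb0 hb1]
        ring
    _ = _ := by
        push_cast
        rw [ENNReal.coe_rpow_of_nonneg _ (by linarith)]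
        rfl

/-- Over an `r`-net, the oscillation in each ball is controlled by the Poincaré inequality at radius
`2r`. The enlarged balls overlap boundedly, so the energy measures add up to at most a multiple of
the total energy. Exhausting `X` by balls keeps the nets finite. -/
theorem exists_ballEnergy_le_energy [hp : Fact (1 < p)] {𝓔 : PEnergyForm p m}
    {Γ : 𝓔.domain → Measure X} (h : IsEnergyFramework 𝓔 Γ) (hVD : VolumeDoubling m) {β : ℝ}
    (hPI : PoincareInequality 𝓔 Γ fun r => r ^ β) :
    ∃ C : ℝ≥0, ∀ (u : 𝓔.domain) (r : ℝ), 0 < r →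
      ballEnergy p m (u : Lp ℝ (ENNReal.ofReal p) m) r
        ≤ C * ENNReal.ofReal (r ^ β) * ENNReal.ofReal (𝓔.energy u) := by
  obtain ⟨C, A, hA, hC⟩ := hPI.exists_enorm
  obtain ⟨K, hK⟩ := hVD.setLIntegral_ballOsc_le hp.out
  obtain ⟨N, hN⟩ := hVD.sum_measure_ball_le (A * 2)
  refine ⟨K * C * (2 ^ β) * N, fun u r hr => ?_⟩
  rcases isEmpty_or_nonempty X with hX | ⟨⟨x₀⟩⟩
  · simp [ballEnergy]
  set f : X → ℝ := ⇑(u : Lp ℝ (ENNReal.ofReal p) m) with hf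
  have hfm : Measurable f := (Lp.stronglyMeasurable _).measurable
  have e : ballEnergy p m f r = m.withDensity (ballOsc p m f r) univ := by
    rw [withDensity_apply _ MeasurableSet.univ, setLIntegral_univ]; rfl
  rw [e]
  refine measure_univ_le_of_forall_ball x₀ fun n => ?_
  obtain ⟨S, hS, hcov⟩ := hVD.exists_net x₀ n hr
  have hloc : ∀ x ∈ S, m.withDensity (ballOsc p m f r) (ball x r)
      ≤ K * (C * ENNReal.ofReal ((2 * r) ^ β)) * Γ u (ball x (A * 2 * r)) := fun x _ => by
    rw [withDensity_apply _ measurableSet_ball]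
    obtain ⟨c, hc⟩ := hC x (2 * r) (by positivity) u
    refine (hK f hfm c x r hr).trans ?_
    rw [mul_assoc (K : ℝ≥0∞), mul_assoc A]
    gcongr
  calc m.withDensity (ballOsc p m f r) (ball x₀ n)
      ≤ m.withDensity (ballOsc p m f r) (⋃ x ∈ S, ball x r) :=
        measure_mono fun y hy => by
          obtain ⟨x, hx, hyx⟩ := hcov y hy
          exact mem_biUnion (s := (S : Set X)) hx hyx
    _ ≤ ∑ x ∈ S, m.withDensity (ballOsc p m f r) (ball x r) := measure_biUnion_finset_le _ _
    _ ≤ ∑ x ∈ S, K * (C * ENNReal.ofReal ((2 * r) ^ β)) * Γ u (ball x (A * 2 * r)) :=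
        Finset.sum_le_sum hloc
    _ ≤ K * (C * ENNReal.ofReal ((2 * r) ^ β)) * (N * Γ u univ) := by
        rw [← Finset.mul_sum]
        gcongr
        exact hN r hr S hS (Γ u)
    _ = _ := by
        have h2 : ENNReal.ofReal (2 ^ β) = ((2 ^ β : ℝ≥0) : ℝ≥0∞) := by
          rw [← ENNReal.ofReal_coe_nnreal]; simp
        rw [h.measure_univ_eq, Real.mul_rpow zero_le_two hr.le,
          ENNReal.ofReal_mul (by positivity), h2]
        push_cast
        ring

theorem domain_subset_besovInfty [hp : Fact (1 < p)] {𝓔 : PEnergyForm p m}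
    {Γ : 𝓔.domain → Measure X} (h : IsEnergyFramework 𝓔 Γ) (hVD : VolumeDoubling m) {β : ℝ}
    (hPI : PoincareInequality 𝓔 Γ fun r => r ^ β) :
    (𝓔.domain : Set (Lp ℝ (ENNReal.ofReal p) m)) ⊆ besovInfty p (β / p) m := by
  intro u hu
  have h0 : 0 < p := zero_lt_one.trans hp.out
  obtain ⟨C, hC⟩ := exists_ballEnergy_le_energy h hVD hPI
  refine (mem_besovInfty_iff h0.le).2 ⟨C * (𝓔.energy ⟨u, hu⟩).toNNReal, fun r hr => ?_⟩
  refine (hC ⟨u, hu⟩ r hr).trans (le_of_eq ?_)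
  rw [mul_div_cancel₀ _ h0.ne']
  push_cast
  rw [mul_right_comm]
  rfl

end LowerBound

/-! ### Telescoping maxima, ball averages, and cutoffs from the capacity. -/

section UpperBound

open Metric

theorem fold_max_eq_of_subset {ι : Type*} {S T : Finset ι} (hT : T ⊆ S) {a : ι → ℝ}
    (h : ∀ i ∈ S, i ∉ T → a i = 0) : T.fold max 0 a = S.fold max 0 a := by
  apply le_antisymm
  · refine (Finset.fold_max_le _).2 ⟨(Finset.le_fold_max _).2 (Or.inl le_rfl), fun i hi => ?_⟩
    exact (Finset.le_fold_max _).2 (Or.inr ⟨i, hT hi, le_rfl⟩)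
  · refine (Finset.fold_max_le _).2 ⟨(Finset.le_fold_max _).2 (Or.inl le_rfl), fun i hi => ?_⟩
    by_cases hiT : i ∈ T
    · exact (Finset.le_fold_max _).2 (Or.inr ⟨i, hiT, le_rfl⟩)
    · exact (Finset.le_fold_max _).2 (Or.inl (h i hi hiT).le)

/-- Telescoping: adding a function to a maximum `M` increases it by the positive part of `ψ - M`. -/
theorem exists_sum_eq_fold_max {ι Y : Type*} (S : Finset ι) (ψ : ι → Y → ℝ) :
    ∃ T : ι → Finset ι, (∀ i, T i ⊆ S) ∧ ∀ x,
      ∑ i ∈ S, max 0 (ψ i x - (T i).fold max 0 fun j => ψ j x) = S.fold max 0 fun j => ψ j x := by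
  classical
  induction S using Finset.induction_on with
  | empty => exact ⟨fun _ => ∅, fun _ => subset_rfl, by simp⟩
  | insert a S ha ih =>
    obtain ⟨T, hT, hsum⟩ := ih
    refine ⟨fun i => if i = a then S else T i, fun i => ?_, fun x => ?_⟩
    · dsimp only
      split_ifs
      · exact Finset.subset_insert a S
      · exact (hT i).trans (Finset.subset_insert a S)
    · rw [Finset.sum_insert ha, Finset.fold_insert ha]
      dsimp only
      rw [if_pos rfl]
      have e : ∀ i ∈ S, max 0 (ψ i x - (if i = a then S else T i).fold max 0 fun j => ψ j x)
          = max 0 (ψ i x - (T i).fold max 0 fun j => ψ j x) := fun i hi => by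
        rw [if_neg (ne_of_mem_of_not_mem hi ha)]
      rw [Finset.sum_congr rfl e, hsum x]
      grind

/-- The differences of successive maxima, written in terms of neighbouring functions only. -/
theorem exists_local_sum_eq_fold_max {ι Y : Type*} (S : Finset ι) (ψ : ι → Y → ℝ)
    (R : ι → ι → Prop)
    (hR : ∀ i ∈ S, ∀ j ∈ S, ∀ x, ψ i x ≠ 0 → ψ j x ≠ 0 → R i j) :
    ∃ T : ι → Finset ι, (∀ i, ∀ j ∈ T i, j ∈ S ∧ R i j) ∧ ∀ x,
      ∑ i ∈ S, max 0 (ψ i x - (T i).fold max 0 fun j => ψ j x) = S.fold max 0 fun j => ψ j x := by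
  classical
  obtain ⟨T, hT, hsum⟩ := exists_sum_eq_fold_max S ψ
  -- Where `ψ i` vanishes the summand is `0` for any `T`; elsewhere every nonzero `ψ j` with `j ∈ T
  -- i` is a neighbour of `i`, so discarding the others changes nothing.
  refine ⟨fun i => (T i).filter (R i), fun i j hj => ?_, fun x => ?_⟩
  · obtain ⟨h1, h2⟩ := Finset.mem_filter.1 hj
    exact ⟨hT i h1, h2⟩
  rw [← hsum x]
  refine Finset.sum_congr rfl fun i hi => ?_
  by_cases hx : ψ i x = 0
  · have h1 : ∀ U : Finset ι, 0 ≤ U.fold max 0 fun j => ψ j x := fun U =>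
      (Finset.le_fold_max _).2 (Or.inl le_rfl)
    rw [hx, max_eq_left (by linarith [h1 ((T i).filter (R i))]), max_eq_left (by linarith [h1 (T i)])]
  · rw [fold_max_eq_of_subset (Finset.filter_subset (R i) (T i)) fun j hj hjR => ?_]
    by_contra hjx
    exact hjR (Finset.mem_filter.2 ⟨hj, hR i hi j (hT i hj) x hx hjx⟩)

variable {X : Type*} [MetricSpace X] [MeasurableSpace X] {m : Measure X} {p : ℝ}
  [hp : Fact (1 < p)]

/-- Jensen's inequality, from monotonicity of `L^q` norms on a probability space. -/
theorem lintegral_enorm_rpow_ge {Y : Type*} [MeasurableSpace Y] {ν : Measure Y}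
    [IsProbabilityMeasure ν] {q : ℝ} (hq : 1 ≤ q) {f : Y → ℝ} (hf : AEStronglyMeasurable f ν) :
    ‖∫ x, f x ∂ν‖ₑ ^ q ≤ ∫⁻ x, ‖f x‖ₑ ^ q ∂ν := by
  have h1 := eLpNorm'_le_eLpNorm'_of_exponent_le zero_lt_one hq ν hf
  simp only [eLpNorm', ENNReal.rpow_one, div_one] at h1
  have hq0 : 0 < q := by linarith
  calc ‖∫ x, f x ∂ν‖ₑ ^ q ≤ ((∫⁻ x, ‖f x‖ₑ ^ q ∂ν) ^ (1 / q)) ^ q :=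
        ENNReal.rpow_le_rpow ((enorm_integral_le_lintegral_enorm f).trans h1) hq0.le
    _ = _ := by rw [← ENNReal.rpow_mul, one_div, inv_mul_cancel₀ hq0.ne', ENNReal.rpow_one]

variable [IsLocallyFiniteMeasure m] [m.IsOpenPosMeasure]

/-- By Jensen, and since `B(x,r)` lies in `B(y,(b+1)r)`, which has comparable measure. -/
theorem VolumeDoubling.enorm_setAverage_sub_rpow_le (h : VolumeDoubling m) {b : ℝ} (hb : 1 ≤ b) :
    ∃ K : ℝ≥0, ∀ (u : Lp ℝ (ENNReal.ofReal p) m) (x y : X) (r : ℝ), 0 < r → dist x y ≤ b * r →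
      ‖(⨍ z in ball x r, u z ∂m) - u y‖ₑ ^ p ≤ K * ballOsc p m u ((b + 1) * r) y := by
  obtain ⟨K, -, hK⟩ := h.comparable (b + 1)
  refine ⟨K, fun u x y r hr hxy => ?_⟩
  have hb0 : m (ball x r) ≠ 0 := (measure_ball_pos m x hr).ne'
  have hb1 : m (ball x r) ≠ ∞ := (h.measure_ball_lt_top x _).ne
  have hB0 : m (ball y ((b + 1) * r)) ≠ 0 := (measure_ball_pos m y (by positivity)).ne'
  have hB1 : m (ball y ((b + 1) * r)) ≠ ∞ := (h.measure_ball_lt_top y _).ne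
  have hfin : IsFiniteMeasure (m.restrict (ball x r)) := ⟨by simpa using hb1.lt_top⟩
  have hne : NeZero (m.restrict (ball x r)) := ⟨by simpa using hb0⟩
  have hint : Integrable u (m.restrict (ball x r)) :=
    ((Lp.memLp u).restrict _).integrable (ENNReal.one_le_ofReal.2 hp.out.le)
  set ν : Measure X := (m.restrict (ball x r) univ)⁻¹ • m.restrict (ball x r) with hν
  have hνp : IsProbabilityMeasure ν := by rw [hν]; infer_instance
  have hintν : Integrable u ν := hint.to_average
  have e1 : (⨍ z in ball x r, u z ∂m) - u y = ∫ z, (u z - u y) ∂ν := by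
    rw [integral_sub hintν (integrable_const _), integral_const, probReal_univ, one_smul]
    rfl
  rw [e1]
  refine (lintegral_enorm_rpow_ge hp.out.le
    (hintν.aestronglyMeasurable.sub aestronglyMeasurable_const)).trans ?_
  have e2 : ∫⁻ z, ‖u z - u y‖ₑ ^ p ∂ν = ⨍⁻ z in ball x r, ‖u z - u y‖ₑ ^ p ∂m := rfl
  change ∫⁻ z, ‖u z - u y‖ₑ ^ p ∂ν ≤ _
  rw [e2, ballOsc, setLAverage_eq, setLAverage_eq, div_eq_mul_inv, div_eq_mul_inv, mul_left_comm]
  refine mul_le_mul' (lintegral_mono_set (ball_subset_ball' (by linarith))) ?_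
  exact ENNReal.inv_le_mul_inv_of_le_mul hB0 hB1 (hK y x r hr (by rw [dist_comm]; linarith))

variable {𝓔 : PEnergyForm p m} {Γ : 𝓔.domain → Measure X} {β : ℝ}

theorem exists_core_cutoff_ball [ProperSpace X] [Nontrivial X] (h : IsEnergyFramework 𝓔 Γ)
    (hVD : VolumeDoubling m) (hcap : CapacityUpperEstimate 𝓔 fun r => r ^ β) :
    ∃ C a r₀ : ℝ, 0 < C ∧ 1 ≤ a ∧ 0 < r₀ ∧ ∀ (x : X) (r : ℝ), 0 < r → r < r₀ →
      ∃ ψ : X → ℝ, 𝓔.CoreBound ψ ((C * m.real (ball x r) / r ^ β) ^ (1 / p)) ∧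
        (∀ y, 0 ≤ ψ y ∧ ψ y ≤ 1) ∧ (∀ y ∈ ball x r, ψ y = 1) ∧
        ∀ y, ψ y ≠ 0 → dist y x < a * r := by
  obtain ⟨C, A₁, A₂, hC, hA₁, hA₂, hcap⟩ := hcap
  obtain ⟨K, hK1, hK⟩ := hVD.comparable 2
  have hdiam : 0 < ediam (univ : Set X) / ENNReal.ofReal A₂ := by
    refine ENNReal.div_pos ?_ ENNReal.ofReal_ne_top
    obtain ⟨a, b, hab⟩ := exists_pair_ne X
    exact ((edist_pos.2 hab).trans_le (edist_le_ediam_of_mem (mem_univ a) (mem_univ b))).ne'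
  obtain ⟨q, hq0, hq⟩ := ENNReal.lt_iff_exists_nnreal_btwn.1 hdiam
  have hq0' : 0 < q := by exact_mod_cast hq0
  have hKpos : (0 : ℝ) < K := zero_lt_one.trans_le (by exact_mod_cast hK1)
  -- The capacity is used at radius `2r`, leaving room for continuous barriers: `χ₁` between
  -- `B(x,r)` and `B(x,2r)`, `χ₂` between `B(x,2A₁r)` and `B(x,4A₁r)`. The `2` in front makes the
  -- bound on the infimum strict, `K` passes from `m(B(x,2r))` to `m(B(x,r))`, and `q/2` keeps `2r`
  -- admissible even when the diameter is infinite.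
  refine ⟨2 * C * K / 2 ^ β, 4 * A₁, q / 2, by positivity, by linarith, by positivity,
    fun x r hr hrq => ?_⟩
  have hb0 : m (ball x (2 * r)) ≠ 0 := (measure_ball_pos m x (by positivity)).ne'
  have hb1 : m (ball x (2 * r)) ≠ ∞ := (hVD.measure_ball_lt_top x _).ne
  set M := m.real (ball x (2 * r)) with hM
  have hMpos : 0 < M := ENNReal.toReal_pos hb0 hb1
  have hrβ : 0 < (2 * r) ^ β := Real.rpow_pos_of_pos (by positivity) _
  have hlt := (hcap x (2 * r) (by positivity) (lt_trans (by
    rw [← ENNReal.ofReal_coe_nnreal]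
    exact (ENNReal.ofReal_lt_ofReal_iff (NNReal.coe_pos.2 hq0')).2 (by linarith)) hq)).trans_lt
    (b := ENNReal.ofReal C * (m (ball x (2 * r)) / ENNReal.ofReal ((2 * r) ^ β)))
    (c := ENNReal.ofReal (2 * C * (M / (2 * r) ^ β))) (by
      rw [← ofReal_measureReal hb1, ← ENNReal.ofReal_div_of_pos hrβ,
        ← ENNReal.ofReal_mul (by linarith)]
      refine (ENNReal.ofReal_lt_ofReal_iff (by positivity)).2 ?_
      have : 0 < C * (M / (2 * r) ^ β) := by positivity
      linarith)
  simp only [iInf_lt_iff] at hlt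
  obtain ⟨ψ, hψ, hψE⟩ := hlt
  have hE : 𝓔.energy ψ < 2 * C * (M / (2 * r) ^ β) :=
    (ENNReal.ofReal_lt_ofReal_iff (by positivity)).1 hψE
  have hMle : M ≤ K * m.real (ball x r) := by
    have h1 := hK x x r hr (by simpa using hr.le)
    have h2 := ENNReal.toReal_mono (ENNReal.mul_ne_top ENNReal.coe_ne_top
      (hVD.measure_ball_lt_top x r).ne) h1
    rwa [ENNReal.toReal_mul, ENNReal.coe_toReal] at h2
  have hsemi : 𝓔.seminorm ψ < (2 * C * K / 2 ^ β * m.real (ball x r) / r ^ β) ^ (1 / p) := by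
    rw [𝓔.seminorm_apply]
    have hp0 := hp.out
    refine Real.rpow_lt_rpow (𝓔.energy_nonneg _) (hE.trans_le ?_) (by positivity)
    rw [Real.mul_rpow zero_le_two hr.le]
    calc 2 * C * (M / (2 ^ β * r ^ β)) ≤ 2 * C * ((K * m.real (ball x r)) / (2 ^ β * r ^ β)) := by
          gcongr
      _ = _ := by field_simp
  obtain ⟨χ₁, t₁, h₁, h₁1, h₁0, h₁b⟩ := h.exists_urysohn (isCompact_closedBall x r)
    (isOpen_ball (x := x) (ε := 2 * r)) (closedBall_subset_ball (by linarith))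
  obtain ⟨χ₂, t₂, h₂, h₂1, h₂0, h₂b⟩ := h.exists_urysohn (isCompact_closedBall x (A₁ * (2 * r)))
    (isOpen_ball (x := x) (ε := 4 * A₁ * r)) (closedBall_subset_ball (by nlinarith))
  have h12 : ∀ y, χ₁ y ≤ χ₂ y := fun y => by
    by_cases hy : y ∈ ball x (2 * r)
    · rw [h₂1 y (ball_subset_closedBall (ball_subset_ball (by nlinarith) hy))]
      exact (h₁b y).2
    · rw [h₁0 y hy]
      exact (h₂b y).1
  obtain ⟨f, hf, hfb⟩ := h.exists_core_cutoff hψ h₁ h₂ (fun y => (h₁b y).1) h12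
    (fun y => (h₂b y).2) h₁0 (fun y hy => h₂1 y (ball_subset_closedBall (not_not.1 hy))) hsemi
  refine ⟨f, hf, fun y => ⟨(h₁b y).1.trans (hfb y).1, (hfb y).2.trans (h₂b y).2⟩,
    fun y hy => le_antisymm ((hfb y).2.trans (h₂b y).2) ?_, fun y hy => ?_⟩
  · rw [← h₁1 y (ball_subset_closedBall hy)]
    exact (hfb y).1
  · by_contra hcon
    have hz := h₂0 y hcon
    exact hy (le_antisymm (hz ▸ (hfb y).2) ((h₁b y).1.trans (hfb y).1))

end UpperBound

/-! ### Partitions of unity and discrete convolutions. -/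

section Approximation

open Metric

variable {X : Type*} [MetricSpace X] [MeasurableSpace X] {m : Measure X} {p : ℝ}
  [hp : Fact (1 < p)]

theorem VolumeDoubling.measureReal_ball_le [IsLocallyFiniteMeasure m] (h : VolumeDoubling m)
    {Λ : ℝ} (hΛ : 1 ≤ Λ) :
    ∃ K : ℝ, 1 ≤ K ∧ ∀ (x y : X) (r : ℝ), 0 < r → dist x y ≤ Λ * r →
      m.real (ball x r) ≤ K * m.real (ball y r) := by
  obtain ⟨K, hK1, hK⟩ := h.comparable Λ
  refine ⟨K, by exact_mod_cast hK1, fun x y r hr hxy => ?_⟩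
  have hr' : r ≤ Λ * r := by nlinarith
  have h1 := (measure_mono (ball_subset_ball hr')).trans (hK x y r hr hxy)
  have h2 := ENNReal.toReal_mono (ENNReal.mul_ne_top ENNReal.coe_ne_top
    (h.measure_ball_lt_top y r).ne) h1
  rwa [ENNReal.toReal_mul, ENNReal.coe_toReal] at h2

theorem enorm_rpow_le_iff {q : ℝ} (hq : 0 < q) {z : ℝ} {Y : ℝ≥0∞} (hY : Y ≠ ∞) :
    ‖z‖ₑ ^ q ≤ Y ↔ |z| ≤ Y.toReal ^ q⁻¹ := by
  rw [Real.le_rpow_inv_iff_of_pos (abs_nonneg z) ENNReal.toReal_nonneg hq,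
    ← ofReal_abs_rpow hq.le, ENNReal.ofReal_le_iff_le_toReal hY]

theorem SeparatedBy.mono {X : Type*} [MetricSpace X] {r : ℝ} {S T : Finset X} (h : SeparatedBy r S) (hT : T ⊆ S) :
    SeparatedBy r T := fun x hx y hy => h x (hT hx) y (hT hy)

variable {𝓔 : PEnergyForm p m} {Γ : 𝓔.domain → Measure X} {β : ℝ}

/-- On `U` the function may be exchanged for one whose total energy is small; this is where strong
locality enters. -/
theorem IsEnergyFramework.measure_le_of_sub_eq_const (h : IsEnergyFramework 𝓔 Γ) {f g : X → ℝ}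
    {s t : ℝ} (v : 𝓔.domain) (hv : (v : Lp ℝ (ENNReal.ofReal p) m) =ᵐ[m] f)
    (hf : 𝓔.CoreBound f s) (hg : 𝓔.CoreBound g t) {U : Set X} (hU : IsOpen U)
    (hfg : ∃ c, ∀ x ∈ U, f x - g x = c) : Γ v U ≤ ENNReal.ofReal (t ^ p) := by
  obtain ⟨w, hw, hwt⟩ := hg.2.2
  have h1 := h.strongly_local v w f g hf.1 hf.2.1 hv hg.1 hg.2.1 hw U hU hfg
  have h2 : Γ v U = Γ w U := by
    rw [← Measure.restrict_apply_self (Γ v), h1, Measure.restrict_apply_self]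
  rw [h2]
  refine (measure_mono (subset_univ U)).trans ?_
  rw [h.measure_univ_eq, 𝓔.energy_eq_rpow]
  exact ENNReal.ofReal_le_ofReal (Real.rpow_le_rpow (apply_nonneg _ _) hwt (by linarith [hp.out]))

variable [BorelSpace X] [IsLocallyFiniteMeasure m] [m.IsOpenPosMeasure]

/-- Partitions of unity in the core, with controlled energy. -/
theorem exists_core_partition [ProperSpace X] [Nontrivial X] (h : IsEnergyFramework 𝓔 Γ)
    (hVD : VolumeDoubling m) (hcap : CapacityUpperEstimate 𝓔 fun r => r ^ β) :
    ∃ D a r₀ : ℝ, 0 < D ∧ 1 ≤ a ∧ 0 < r₀ ∧ ∀ r : ℝ, 0 < r → r < r₀ → ∀ S : Finset X,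
      SeparatedBy r S → ∃ φ : X → X → ℝ,
        (∀ i ∈ S, 𝓔.CoreBound (φ i) (D * (m.real (ball i r) / r ^ β) ^ (1 / p))) ∧
        (∀ i y, 0 ≤ φ i y) ∧ (∀ i ∈ S, ∀ y, φ i y ≠ 0 → dist y i < a * r) ∧
        ∀ i ∈ S, ∀ y ∈ ball i r, ∑ k ∈ S, φ k y = 1 := by
  obtain ⟨C, a, r₀, hC, ha, hr₀, hcut⟩ := exists_core_cutoff_ball h hVD hcap
  obtain ⟨N, hN⟩ := hVD.card_le (2 * a)
  obtain ⟨K, hK1, hK⟩ := hVD.measureReal_ball_le (Λ := 2 * a) (by linarith)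
  have hp0 := hp.out
  -- Each `φ i` involves `ψ i` and at most `N` neighbours, and `K` compares the masses of
  -- neighbouring balls.
  refine ⟨(1 + N) * (C * K) ^ (1 / p), a, r₀, by positivity, ha, hr₀, fun r hr hrr₀ S hS => ?_⟩
  choose ψ hψ hψb hψ1 hψ0 using fun x => hcut x r hr hrr₀
  obtain ⟨T, hT, hsum⟩ := exists_local_sum_eq_fold_max S ψ (fun i j => dist j i < 2 * a * r)
    fun i _ j _ x hi hj => by
      have h1 := hψ0 i x hi
      have h2 := hψ0 j x hj
      have h3 := dist_triangle_left j i x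
      linarith
  have hrβ : 0 < r ^ β := Real.rpow_pos_of_pos hr _
  refine ⟨fun i x => max 0 (ψ i x - (T i).fold max 0 fun j => ψ j x), fun i hi => ?_,
    fun i y => le_max_left _ _, fun i _ y hy => ?_, fun i hi y hy => ?_⟩
  · refine (h.coreBound_max PEnergyForm.CoreBound.zero
      ((hψ i).sub (h.coreBound_fold_max fun j _ => hψ j))).mono ?_
    set τ := (C * K) ^ (1 / p) * (m.real (ball i r) / r ^ β) ^ (1 / p)
    have hτ : ∀ j, dist j i < 2 * a * r → (C * m.real (ball j r) / r ^ β) ^ (1 / p) ≤ τ := by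
      intro j hj
      have e : τ = (C * K * (m.real (ball i r) / r ^ β)) ^ (1 / p) :=
        (Real.mul_rpow (by positivity) (by positivity)).symm
      rw [e]
      refine Real.rpow_le_rpow (by positivity) ?_ (by positivity)
      calc C * m.real (ball j r) / r ^ β ≤ C * (K * m.real (ball i r)) / r ^ β := by
            gcongr
            exact hK j i r hr hj.le
        _ = _ := by ring
    have hcard : ((T i).card : ℝ) ≤ N := by
      exact_mod_cast hN r hr i (T i) (hS.mono fun j hj => (hT i j hj).1) fun j hj => (hT i j hj).2
    have hτ0 : 0 ≤ τ := by positivity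
    calc _ ≤ 0 + (τ + ∑ j ∈ T i, τ) := by
          gcongr with j hj
          · exact hτ i (by rw [dist_self]; positivity)
          · exact hτ j (hT i j hj).2
      _ = (1 + (T i).card) * τ := by rw [Finset.sum_const, nsmul_eq_mul]; ring
      _ ≤ (1 + N) * τ := by gcongr
      _ = _ := by ring
  · refine hψ0 i y fun hz => hy ?_
    have : 0 ≤ (T i).fold max 0 fun j => ψ j y := (Finset.le_fold_max _).2 (Or.inl le_rfl)
    dsimp only
    rw [hz]
    exact max_eq_left (by linarith)
  · rw [hsum y]
    refine le_antisymm ((Finset.fold_max_le _).2 ⟨zero_le_one, fun j _ => (hψb j y).2⟩) ?_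
    exact (Finset.le_fold_max _).2 (Or.inr ⟨i, hi, (hψ1 i y hy).ge⟩)

/-- Discrete convolutions approximate `u` with energy controlled by the Besov energy. -/
theorem exists_approximation [ProperSpace X] [Nontrivial X] (h : IsEnergyFramework 𝓔 Γ)
    (hVD : VolumeDoubling m) (hcap : CapacityUpperEstimate 𝓔 fun r => r ^ β) :
    ∃ C Λ r₀ : ℝ, 0 < C ∧ 0 < Λ ∧ 0 < r₀ ∧ ∀ (u : Lp ℝ (ENNReal.ofReal p) m) (x₀ : X) (R r : ℝ),
      0 < r → r < r₀ → ballEnergy p m u (Λ * r) ≠ ∞ → ∃ v : 𝓔.domain,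
        Γ v (ball x₀ R) ≤ ENNReal.ofReal (C / r ^ β) * ballEnergy p m u (Λ * r) ∧
        ∫⁻ y in ball x₀ R, ‖(v : Lp ℝ (ENNReal.ofReal p) m) y - u y‖ₑ ^ p ∂m
          ≤ ENNReal.ofReal C * ballEnergy p m u (Λ * r) := by
  obtain ⟨D, a, r₀, hD, ha, hr₀, hpart⟩ := exists_core_partition h hVD hcap
  obtain ⟨K, hK⟩ := hVD.enorm_setAverage_sub_rpow_le (p := p) (b := 2 * a + 1) (by linarith)
  obtain ⟨N, hN⟩ := hVD.card_le (2 * a)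
  obtain ⟨N', hN'⟩ := hVD.sum_setLIntegral_ball_le 1
  obtain ⟨K', hK'1, hK'⟩ := hVD.measureReal_ball_le (Λ := 2 * a) (by linarith)
  have hp1 := hp.out
  have hp0 : 0 < p := by linarith
  set L : ℝ≥0 := 2 ^ (p - 1) * (K + K) with hL
  set C₁ : ℝ := (N * D) ^ p * K' * L * N' with hC₁
  have hC₁0 : 0 ≤ C₁ := by positivity
  -- `C₁` serves the energy, `K` the `Lᵖ` error, and `1` positivity. A point of `B(j,r)` is within
  -- `(2a+1)r` of a centre neighbouring `j`, and the average there reaches one more `r`.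
  refine ⟨C₁ + K + 1, 2 * a + 1 + 1, r₀, by positivity, by positivity, hr₀,
    fun u x₀ R r hr hrr₀ hfin => ?_⟩
  obtain ⟨S, hS, hcov⟩ := hVD.exists_net x₀ R hr
  obtain ⟨φ, hφE, hφ0, hφs, hφ1⟩ := hpart r hr hrr₀ S hS
  set g := ballOsc p m u ((2 * a + 1 + 1) * r) with hg
  set G := ballEnergy p m u ((2 * a + 1 + 1) * r) with hG
  have hgG : ∫⁻ y, g y ∂m = G := rfl
  set c : X → ℝ := fun x => ⨍ z in ball x r, u z ∂m with hc
  have hcu : ∀ x y, dist y x ≤ (2 * a + 1) * r → ‖c x - u y‖ₑ ^ p ≤ K * g y := fun x y hxy =>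
    hK u x y r hr (by rwa [dist_comm])
  have hrβ : 0 < r ^ β := Real.rpow_pos_of_pos hr _
  have hb0 : ∀ x, m (ball x r) ≠ 0 := fun x => (measure_ball_pos m x hr).ne'
  have hb1 : ∀ x, m (ball x r) ≠ ∞ := fun x => (hVD.measure_ball_lt_top x _).ne
  have hf : 𝓔.CoreBound (fun y => ∑ i ∈ S, c i * φ i y) _ :=
    PEnergyForm.CoreBound.finset_sum fun i hi => (hφE i hi).const_mul (c i)
  obtain ⟨v, hv, -⟩ := hf.2.2
  refine ⟨v, ?_, ?_⟩
  · have hI : ∀ j, ∫⁻ y in ball j r, g y ∂m ≠ ∞ := fun j =>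
      ne_top_of_le_ne_top hfin (setLIntegral_le_lintegral _ _)
    -- Neighbouring averages are compared through `u y`, then integrated over `y` in `B(j,r)`.
    have hcc : ∀ i j, dist j i < 2 * a * r →
        ‖c i - c j‖ₑ ^ p ≤ L * (∫⁻ y in ball j r, g y ∂m) / m (ball j r) := by
      intro i j hij
      rw [ENNReal.le_div_iff_mul_le (Or.inl (hb0 j)) (Or.inl (hb1 j)), ← setLIntegral_const,
        ← lintegral_const_mul' _ _ ENNReal.coe_ne_top]
      refine setLIntegral_mono' measurableSet_ball fun y hy => ?_
      have hyj : dist y j < r := hy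
      have h1 := hcu i y (by linarith [dist_triangle y j i])
      have h2 := hcu j y (by nlinarith)
      have h3 := enorm_sub_rpow_le hp1.le (c i - u y) (c j - u y)
      rw [sub_sub_sub_cancel_right] at h3
      refine h3.trans ((mul_le_mul_right (add_le_add h1 h2) _).trans (le_of_eq ?_))
      rw [hL]
      push_cast
      rw [ENNReal.coe_rpow_of_nonneg _ (by linarith), ← add_mul, ← mul_assoc]
      rfl
    have hloc : ∀ j ∈ S, Γ v (ball j r)
        ≤ ENNReal.ofReal ((N * D) ^ p * K' * L / r ^ β) * ∫⁻ y in ball j r, g y ∂m := by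
      intro j hj
      set I := ∫⁻ y in ball j r, g y ∂m
      set M := m.real (ball j r) with hM
      have hM0 : 0 < M := ENNReal.toReal_pos (hb0 j) (hb1 j)
      set δ : ℝ := (L * I / m (ball j r)).toReal ^ p⁻¹ with hδ
      have hδ0 : 0 ≤ δ := Real.rpow_nonneg ENNReal.toReal_nonneg _
      have hδp : δ ^ p = L * I.toReal / M := by
        rw [hδ, ← Real.rpow_mul ENNReal.toReal_nonneg, inv_mul_cancel₀ hp0.ne', Real.rpow_one,
          ENNReal.toReal_div, ENNReal.toReal_mul, ENNReal.coe_toReal]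
        rfl
      have hY : L * I / m (ball j r) ≠ ∞ :=
        ENNReal.div_ne_top (ENNReal.mul_ne_top ENNReal.coe_ne_top (hI j)) (hb0 j)
      have hcδ : ∀ i, dist j i < 2 * a * r → |c i - c j| ≤ δ := fun i hi =>
        (enorm_rpow_le_iff hp0 hY).1 (hcc i j hi)
      set S' := S.filter fun i => dist i j < 2 * a * r with hS'
      have hw : 𝓔.CoreBound (fun y => ∑ i ∈ S', (c i - c j) * φ i y) _ :=
        PEnergyForm.CoreBound.finset_sum fun i hi =>
          (hφE i (Finset.mem_filter.1 hi).1).const_mul (c i - c j)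
      set t := N * D * (K' ^ (1 / p) * δ * (M / r ^ β) ^ (1 / p)) with ht
      have hcard : (S'.card : ℝ) ≤ N := by
        exact_mod_cast hN r hr j S' (hS.mono (Finset.filter_subset _ _)) fun i hi =>
          (Finset.mem_filter.1 hi).2
      have hbound : ∑ i ∈ S', |c i - c j| * (D * (m.real (ball i r) / r ^ β) ^ (1 / p)) ≤ t := by
        calc _ ≤ ∑ i ∈ S', δ * (D * (K' ^ (1 / p) * (M / r ^ β) ^ (1 / p))) := by
              refine Finset.sum_le_sum fun i hi => ?_
              have hij := (Finset.mem_filter.1 hi).2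
              gcongr
              · exact hcδ i (by rwa [dist_comm])
              · rw [← Real.mul_rpow (by positivity) (by positivity), ← mul_div_assoc]
                gcongr
                exact hK' i j r hr hij.le
          _ = S'.card * D * (K' ^ (1 / p) * δ * (M / r ^ β) ^ (1 / p)) := by
              rw [Finset.sum_const, nsmul_eq_mul]; ring
          _ ≤ t := by rw [ht]; gcongr
      have htp : t ^ p = (N * D) ^ p * K' * L / r ^ β * I.toReal := by
        have e1 : ∀ z : ℝ, 0 ≤ z → (z ^ (1 / p)) ^ p = z := fun z hz => by
          rw [← Real.rpow_mul hz, one_div, inv_mul_cancel₀ hp0.ne', Real.rpow_one]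
        rw [ht, Real.mul_rpow (x := N * D) (by positivity) (by positivity),
          Real.mul_rpow (x := K' ^ (1 / p) * δ) (by positivity) (by positivity), Real.mul_rpow (y := δ) (by positivity) hδ0,
          e1 _ (by positivity), e1 _ (by positivity), hδp]
        field_simp
      -- On `B(j,r)` the partition sums to `1` and only neighbours of `j` contribute, so subtracting
      -- the constant `c j` leaves boundedly many terms with small coefficients `c i - c j`.
      have hconst : ∃ b, ∀ y ∈ ball j r,
          (∑ i ∈ S, c i * φ i y) - ∑ i ∈ S', (c i - c j) * φ i y = b := by
        refine ⟨c j, fun y hy => ?_⟩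
        have e1 : ∑ i ∈ S', (c i - c j) * φ i y = ∑ i ∈ S, (c i - c j) * φ i y := by
          refine Finset.sum_filter_of_ne fun i hi hne => ?_
          have h1 := hφs i hi y (right_ne_zero_of_mul hne)
          have h2 : dist y j < r := hy
          have h3 := dist_triangle_left i j y
          nlinarith
        rw [e1, ← Finset.sum_sub_distrib]
        simp only [sub_mul, sub_sub_cancel]
        rw [← Finset.mul_sum, hφ1 j hj y hy, mul_one]
      refine (h.measure_le_of_sub_eq_const v hv hf (hw.mono hbound) isOpen_ball hconst).trans ?_
      rw [htp, ENNReal.ofReal_mul (by positivity), ENNReal.ofReal_toReal (hI j)]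
    calc Γ v (ball x₀ R) ≤ Γ v (⋃ j ∈ S, ball j r) := measure_mono fun y hy => by
          obtain ⟨x, hx, hyx⟩ := hcov y hy
          exact mem_biUnion (s := (S : Set X)) hx hyx
      _ ≤ ∑ j ∈ S, Γ v (ball j r) := measure_biUnion_finset_le _ _
      _ ≤ ∑ j ∈ S, ENNReal.ofReal ((N * D) ^ p * K' * L / r ^ β) * ∫⁻ y in ball j r, g y ∂m :=
          Finset.sum_le_sum hloc
      _ ≤ ENNReal.ofReal ((N * D) ^ p * K' * L / r ^ β) * (N' * G) := by
          rw [← Finset.mul_sum]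
          gcongr
          have := hN' r hr S hS g
          rwa [one_mul] at this
      _ = ENNReal.ofReal (C₁ / r ^ β) * G := by
          rw [← mul_assoc, ← ENNReal.ofReal_natCast N', ← ENNReal.ofReal_mul (by positivity), hC₁]
          congr 2
          ring
      _ ≤ _ := by
          gcongr
          have : (0 : ℝ) ≤ K := K.2
          linarith
  · have hpt : ∀ y ∈ ball x₀ R, (v : Lp ℝ (ENNReal.ofReal p) m) y = ∑ i ∈ S, c i * φ i y →
        ‖(v : Lp ℝ (ENNReal.ofReal p) m) y - u y‖ₑ ^ p ≤ K * g y := by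
      intro y hy hvy
      obtain ⟨j, hj, hyj⟩ := hcov y hy
      rcases eq_or_ne (K * g y) ∞ with htop | htop
      · rw [htop]; exact le_top
      rw [hvy, enorm_rpow_le_iff hp0 htop]
      have h1 := hφ1 j hj y hyj
      -- The error is a convex combination of the `c i - u y` over centres near `y`.
      have e : (∑ i ∈ S, c i * φ i y) - u y = ∑ i ∈ S, φ i y * (c i - u y) := by
        simp only [mul_sub, Finset.sum_sub_distrib, ← Finset.sum_mul, h1, one_mul, mul_comm]
      rw [e]
      calc |∑ i ∈ S, φ i y * (c i - u y)| ≤ ∑ i ∈ S, |φ i y * (c i - u y)| :=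
            Finset.abs_sum_le_sum_abs _ _
        _ ≤ ∑ i ∈ S, φ i y * (K * g y).toReal ^ p⁻¹ := by
            refine Finset.sum_le_sum fun i hi => ?_
            rw [abs_mul, abs_of_nonneg (hφ0 i y)]
            rcases eq_or_ne (φ i y) 0 with hz | hz
            · simp [hz]
            · refine mul_le_mul_of_nonneg_left ((enorm_rpow_le_iff hp0 htop).1
                (hcu i y ?_)) (hφ0 i y)
              have := hφs i hi y hz
              nlinarith
        _ = _ := by rw [← Finset.sum_mul, h1, one_mul]
    calc _ ≤ ∫⁻ y in ball x₀ R, K * g y ∂m := by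
          refine lintegral_mono_ae ((ae_restrict_iff' measurableSet_ball).2 ?_)
          filter_upwards [hv] with y hvy hy using hpt y hy hvy
      _ ≤ ∫⁻ y, K * g y ∂m := setLIntegral_le_lintegral _ _
      _ = K * G := lintegral_const_mul' _ _ ENNReal.coe_ne_top
      _ ≤ _ := by
          rw [← ENNReal.ofReal_coe_nnreal]
          gcongr
          linarith

end Approximation

/-! ### Rigidity above the critical exponent. -/

section Constancy

open Filter Topology Metric

/-- A function that is approximated in `L^q` by constants is constant. -/
theorem exists_ae_eq_const {Y : Type*} [MeasurableSpace Y] {μ : Measure Y} {q : ℝ≥0∞} (hq : q ≠ 0)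
    {f : Y → ℝ} (hf : AEStronglyMeasurable f μ)
    (h : ∀ ε : ℝ≥0∞, 0 < ε → ∃ c : ℝ, eLpNorm (fun x => f x - c) q μ ≤ ε) :
    ∃ c : ℝ, ∀ᵐ x ∂μ, f x = c := by
  have h' : ∀ n : ℕ, ∃ c : ℝ, eLpNorm (fun x => f x - c) q μ ≤ (n : ℝ≥0∞)⁻¹ := fun n =>
    h _ (by simp)
  choose c hc using h'
  have hlim : Tendsto (fun n => eLpNorm ((fun _ => c n) - f) q μ) atTop (𝓝 0) := by
    refine tendsto_of_tendsto_of_tendsto_of_le_of_le tendsto_const_nhds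
      ENNReal.tendsto_inv_nat_nhds_zero (fun _ => zero_le) fun n => ?_
    rw [eLpNorm_sub_comm]
    exact hc n
  obtain ⟨ns, -, hns⟩ := (tendstoInMeasure_of_tendsto_eLpNorm hq
    (fun n => aestronglyMeasurable_const) hf hlim).exists_seq_tendsto_ae
  rcases eq_or_ne μ 0 with rfl | hμ
  · exact ⟨0, by simp⟩
  have : NeZero μ := ⟨hμ⟩
  obtain ⟨x, hx⟩ := hns.exists
  exact ⟨f x, hns.mono fun y hy => tendsto_nhds_unique hy hx⟩

variable {X : Type*} [MetricSpace X] [MeasurableSpace X] {m : Measure X} {p : ℝ}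
  [hp : Fact (1 < p)]

theorem eLpNorm_ofReal_eq {Y : Type*} [MeasurableSpace Y] {μ : Measure Y} {q : ℝ} (hq : 0 < q)
    (f : Y → ℝ) : eLpNorm f (ENNReal.ofReal q) μ = (∫⁻ x, ‖f x‖ₑ ^ q ∂μ) ^ q⁻¹ := by
  rw [eLpNorm_eq_lintegral_rpow_enorm_toReal (by simpa using hq) ENNReal.ofReal_ne_top,
    ENNReal.toReal_ofReal hq.le, one_div]

/-- The constants agree because all the balls contain `ball x₀ 1`, which has positive measure. -/
theorem exists_ae_eq_const_of_forall_ball [m.IsOpenPosMeasure] (x₀ : X) {f : X → ℝ}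
    [OpensMeasurableSpace X] (h : ∀ n : ℕ, ∃ c : ℝ, ∀ᵐ x ∂m.restrict (ball x₀ (n + 1)), f x = c) :
    ∃ c : ℝ, ∀ᵐ x ∂m, f x = c := by
  simp only [ae_restrict_iff' measurableSet_ball] at h
  choose c hc using h
  have hc0 : ∀ n, c n = c 0 := fun n => by
    by_contra hne
    have h1 : ∀ᵐ x ∂m, x ∉ ball x₀ 1 := by
      filter_upwards [hc n, hc 0] with x h1 h2 hx
      refine hne ((h1 (ball_subset_ball (by simp) hx)).symm.trans (h2 ?_))
      simpa using hx
    have h2 := measure_ball_pos m x₀ one_pos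
    rw [ae_iff] at h1
    simp only [not_not, ofPred_mem_eq] at h1
    exact h2.ne' h1
  refine ⟨c 0, ?_⟩
  filter_upwards [ae_all_iff.2 hc] with x hx
  obtain ⟨n, hn⟩ := exists_nat_gt (dist x x₀)
  rw [hx n (mem_ball.2 (by linarith)), hc0]

/-- `Lᵖ` limits of constants are constant, but the indicator of a ball disjoint from another ball is
not. -/
theorem containsNonconstant_of_dense [Nontrivial X] [OpensMeasurableSpace X]
    [IsLocallyFiniteMeasure m] [m.IsOpenPosMeasure] (hVD : VolumeDoubling m)
    {B : Set (Lp ℝ (ENNReal.ofReal p) m)} (hB : Dense B) : ContainsNonconstant B := by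
  by_contra hcon
  obtain ⟨x, y, hxy⟩ := exists_pair_ne X
  set r := dist x y / 2
  have hr : 0 < r := half_pos (dist_pos.2 hxy)
  have hdisj : Disjoint (ball x r) (ball y r) := ball_disjoint_ball (by simp [r])
  have hb1 : m (ball x r) ≠ ∞ := (hVD.measure_ball_lt_top x r).ne
  set u : Lp ℝ (ENNReal.ofReal p) m :=
    indicatorConstLp (ENNReal.ofReal p) measurableSet_ball hb1 (1 : ℝ)
  have hu : u =ᵐ[m] (ball x r).indicator fun _ => 1 := indicatorConstLp_coeFn
  obtain ⟨c, hc⟩ : ∃ c : ℝ, ∀ᵐ z ∂m, u z = c := by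
    refine exists_ae_eq_const (q := ENNReal.ofReal p) (by have := hp.out; simp; linarith)
      (Lp.aestronglyMeasurable u) fun ε hε => ?_
    obtain ⟨v, hv, huv⟩ := EMetric.mem_closure_iff.1 (hB u) ε hε
    obtain ⟨c, hc⟩ := not_not.1 fun hne => hcon ⟨v, hv, hne⟩
    refine ⟨c, ?_⟩
    rw [Lp.edist_def] at huv
    refine (le_of_eq (eLpNorm_congr_ae ?_)).trans huv.le
    filter_upwards [hc] with z hz
    rw [Pi.sub_apply, hz]
  have hex : ∀ z, ∃ w ∈ ball z r, u w = c ∧ u w = (ball x r).indicator (fun _ => 1) w := by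
    intro z
    by_contra! hno
    have h1 : ∀ᵐ w ∂m, w ∉ ball z r := by
      filter_upwards [hc, hu] with w h1 h2 hw using hno w hw h1 h2
    rw [ae_iff] at h1
    simp only [not_not, ofPred_mem_eq] at h1
    exact (measure_ball_pos m z hr).ne' h1
  obtain ⟨w, hw, hw1, hw2⟩ := hex x
  obtain ⟨w', hw', hw1', hw2'⟩ := hex y
  rw [indicator_of_mem hw, hw1] at hw2
  rw [indicator_of_notMem (disjoint_right.1 hdisj hw'), hw1'] at hw2'
  exact one_ne_zero (hw2.symm.trans hw2')

theorem exists_ae_eq_const_of_mem_besovInfty [BorelSpace X] [IsLocallyFiniteMeasure m]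
    [m.IsOpenPosMeasure] [ProperSpace X] [Nontrivial X] {𝓔 : PEnergyForm p m}
    {Γ : 𝓔.domain → Measure X} {β : ℝ} (h : IsEnergyFramework 𝓔 Γ) (hβ : 0 < β)
    (hVD : VolumeDoubling m) (hPI : PoincareInequality 𝓔 Γ fun r => r ^ β)
    (hcap : CapacityUpperEstimate 𝓔 fun r => r ^ β) {θ : ℝ} (hθ : β / p < θ)
    {u : Lp ℝ (ENNReal.ofReal p) m} (hu : u ∈ besovInfty p θ m) :
    ∃ c : ℝ, ∀ᵐ x ∂m, u x = c := by
  have hp1 := hp.out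
  have hp0 : 0 < p := by linarith
  have hβθ : β < p * θ := by rwa [div_lt_iff₀' hp0] at hθ
  obtain ⟨M, hM⟩ := (mem_besovInfty_iff hp0.le).1 hu
  obtain ⟨C, Λ, r₀, hC, hΛ, hr₀, happ⟩ := exists_approximation h hVD hcap
  obtain ⟨C', A, hA, hC'⟩ := hPI.exists_enorm
  obtain ⟨x₀⟩ : Nonempty X := inferInstance
  refine exists_ae_eq_const_of_forall_ball x₀ fun n => ?_
  set R : ℝ := (n : ℝ) + 1
  have hR : 0 < R := by positivity
  have hRA : R ≤ A * R := by nlinarith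
  refine exists_ae_eq_const (q := ENNReal.ofReal p) (by simpa using hp0)
    (Lp.aestronglyMeasurable u).restrict fun ε hε => ?_
  set D : ℝ≥0∞ := 2 ^ (p - 1)
  have hD : D ≠ ∞ := (ENNReal.rpow_lt_top_of_nonneg (by linarith) (by simp)).ne
  -- The first term bounds `v - u` on `B(x₀,R)`; the second is the Poincaré bound for `v`, with
  -- energy of order `r^{pθ-β}`. Both exponents of `r` are positive.
  let E : ℝ → ℝ≥0∞ := fun r =>
    D * (ENNReal.ofReal (C * (Λ * r) ^ (p * θ)) * M
      + C' * ENNReal.ofReal (R ^ β) * (ENNReal.ofReal (C * Λ ^ (p * θ) * r ^ (p * θ - β)) * M))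
  have hE : Tendsto E (𝓝[>] 0) (𝓝 0) := by
    have h1 : Tendsto (fun r : ℝ => C * (Λ * r) ^ (p * θ)) (𝓝[>] 0) (𝓝 0) := by
      have : Continuous fun r : ℝ => C * (Λ * r) ^ (p * θ) :=
        ((continuous_const.mul continuous_id).rpow_const fun _ => Or.inr (by linarith)).const_mul C
      have h2 := (this.tendsto 0).mono_left (nhdsWithin_le_nhds (s := Ioi 0))
      rwa [mul_zero, Real.zero_rpow (by linarith), mul_zero] at h2
    have h2 : Tendsto (fun r : ℝ => C * Λ ^ (p * θ) * r ^ (p * θ - β)) (𝓝[>] 0) (𝓝 0) := by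
      have : Continuous fun r : ℝ => C * Λ ^ (p * θ) * r ^ (p * θ - β) :=
        (continuous_id.rpow_const fun _ => Or.inr (by linarith)).const_mul _
      have h2 := (this.tendsto 0).mono_left (nhdsWithin_le_nhds (s := Ioi 0))
      rwa [Real.zero_rpow (by linarith), mul_zero] at h2
    have h3 := ENNReal.tendsto_ofReal h1
    have h4 := ENNReal.tendsto_ofReal h2
    rw [ENNReal.ofReal_zero] at h3 h4
    have h5 := ENNReal.Tendsto.mul_const (b := M) h3 (Or.inr ENNReal.coe_ne_top)
    have h6 := ENNReal.Tendsto.const_mul (a := C' * ENNReal.ofReal (R ^ β))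
      (ENNReal.Tendsto.mul_const (b := M) h4 (Or.inr ENNReal.coe_ne_top))
      (Or.inr (ENNReal.mul_ne_top ENNReal.coe_ne_top ENNReal.ofReal_ne_top))
    have h7 := ENNReal.Tendsto.const_mul (a := D) (h5.add h6) (Or.inr hD)
    simpa using h7
  have hεp : 0 < ε ^ p := ENNReal.rpow_pos_of_nonneg hε hp0.le
  obtain ⟨r, hrE, hr⟩ := ((hE.eventually (ge_mem_nhds hεp)).and
    (Ioo_mem_nhdsGT hr₀)).exists
  obtain ⟨hr0, hrr₀⟩ := hr
  have hB := hM (Λ * r) (by positivity)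
  -- The larger ball is the one on which the Poincaré inequality measures the energy.
  obtain ⟨v, hv1, hv2⟩ := happ u x₀ (A * R) r hr0 hrr₀
    (ne_top_of_le_ne_top (ENNReal.mul_ne_top ENNReal.coe_ne_top ENNReal.ofReal_ne_top) hB)
  obtain ⟨c, hc⟩ := hC' x₀ R hR v
  refine ⟨c, ?_⟩
  rw [eLpNorm_ofReal_eq hp0, ENNReal.rpow_inv_le_iff hp0]
  refine le_trans ?_ hrE
  set w : X → ℝ := ⇑(v : Lp ℝ (ENNReal.ofReal p) m)
  have hwm : Measurable w := (Lp.stronglyMeasurable _).measurable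
  have hum : Measurable u := (Lp.stronglyMeasurable _).measurable
  have hrβ : 0 < r ^ β := Real.rpow_pos_of_pos hr0 _
  calc ∫⁻ x in ball x₀ R, ‖u x - c‖ₑ ^ p ∂m
      ≤ ∫⁻ x in ball x₀ R, D * (‖w x - u x‖ₑ ^ p + ‖w x - c‖ₑ ^ p) ∂m := by
        refine lintegral_mono fun x => ?_
        have := enorm_sub_rpow_le hp1.le (w x - c) (w x - u x)
        rwa [sub_sub_sub_cancel_left, add_comm] at this
    _ = D * ((∫⁻ x in ball x₀ R, ‖w x - u x‖ₑ ^ p ∂m)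
          + ∫⁻ x in ball x₀ R, ‖w x - c‖ₑ ^ p ∂m) := by
        rw [lintegral_const_mul' _ _ hD, lintegral_add_left]
        exact ((hwm.sub hum).enorm).pow_const p
    _ ≤ E r := by
        simp only [E]
        gcongr
        · refine (lintegral_mono_set (ball_subset_ball hRA)).trans (hv2.trans ?_)
          rw [ENNReal.ofReal_mul hC.le, mul_assoc, mul_comm (ENNReal.ofReal ((Λ * r) ^ (p * θ)))]
          gcongr
        · refine hc.trans ?_
          gcongr
          refine hv1.trans ?_
          calc _ ≤ ENNReal.ofReal (C / r ^ β) * (M * ENNReal.ofReal ((Λ * r) ^ (p * θ))) := by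
                gcongr
            _ = _ := by
                rw [mul_left_comm, ← ENNReal.ofReal_mul (by positivity), mul_comm]
                congr 2
                rw [Real.mul_rpow hΛ.le hr0.le, Real.rpow_sub hr0]
                ring

/-- Neither monotonicity of `P` nor its validity at `a` matters for the supremum. -/
theorem iSup_ofReal_eq {P : ℝ → Prop} {a : ℝ} (h1 : ∀ θ, 0 < θ → θ < a → P θ)
    (h2 : ∀ θ, 0 < θ → P θ → θ ≤ a) :
    ⨆ (θ : ℝ) (_ : 0 < θ ∧ P θ), ENNReal.ofReal θ = ENNReal.ofReal a := by
  refine le_antisymm (iSup₂_le fun θ hθ => ENNReal.ofReal_le_ofReal (h2 θ hθ.1 hθ.2)) ?_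
  refine le_of_forall_lt fun c hc => ?_
  obtain ⟨q, hcq, hqa⟩ := ENNReal.lt_iff_exists_nnreal_btwn.1 hc
  have hq0 : (0 : ℝ) < q := by exact_mod_cast pos_of_gt hcq
  have hqa' : (q : ℝ) < a := by
    rw [← ENNReal.ofReal_coe_nnreal] at hqa
    exact lt_of_not_ge fun hle => hqa.not_ge (ENNReal.ofReal_le_ofReal hle)
  refine hcq.trans_le ?_
  rw [← ENNReal.ofReal_coe_nnreal]
  exact le_iSup₂ (f := fun (θ : ℝ) (_ : 0 < θ ∧ P θ) => ENNReal.ofReal θ) (q : ℝ)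
    ⟨hq0, h1 q hq0 hqa'⟩

end Constancy

/-! ### Equality of the four exponents. -/

theorem mainTheorem7 {X : Type*} [MetricSpace X] [CompleteSpace X] [LocallyCompactSpace X]
    [TopologicalSpace.SeparableSpace X] [Nontrivial X] [MeasurableSpace X] [BorelSpace X]
    (m : Measure X) [m.Regular] [m.IsOpenPosMeasure]
    (p : ℝ) [Fact (1 < p)] (𝓔 : PEnergyForm p m) (Γ : 𝓔.domain → Measure X)
    (hframework : IsEnergyFramework 𝓔 Γ)
    (β : ℝ) (hβ : 0 < β)
    (hVD : VolumeDoubling m)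
    (hPI : PoincareInequality 𝓔 Γ (fun r => r ^ β))
    (hcap : CapacityUpperEstimate 𝓔 (fun r => r ^ β)) :
    besovExponent p m = ENNReal.ofReal (β / p) ∧
    besovExponentStar p m = ENNReal.ofReal (β / p) ∧
    besovExponentPP p m = ENNReal.ofReal (β / p) ∧
    besovExponentPPStar p m = ENNReal.ofReal (β / p) := by
  have : SecondCountableTopology X := UniformSpace.secondCountable_of_separable X
  have : ProperSpace X := hVD.properSpace
  -- Density of the `(p,p)` space and constancy in the `(p,∞)` space are the extreme cases;
  -- inclusion of the spaces and density implying a nonconstant element give the rest.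
  have lower : ∀ θ, 0 < θ → θ < β / p → Dense (besovPP p θ m) := fun θ h0 hθ =>
    hframework.dense_domain.mono
      ((domain_subset_besovInfty hframework hVD hPI).trans (besovInfty_subset_besovPP hVD h0 hθ))
  have upper : ∀ θ, 0 < θ → ContainsNonconstant (besovInfty p θ m) → θ ≤ β / p := by
    rintro θ h0 ⟨u, hu, hne⟩
    by_contra! hθ
    exact hne (exists_ae_eq_const_of_mem_besovInfty hframework hβ hVD hPI hcap hθ hu)
  have mono : ∀ θ, 0 < θ → ContainsNonconstant (besovPP p θ m) →
      ContainsNonconstant (besovInfty p θ m) := fun θ h0 ⟨u, hu, hne⟩ =>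
    ⟨u, besovPP_subset_besovInfty h0 hu, hne⟩
  have dense : ∀ θ, 0 < θ → θ < β / p → Dense (besovInfty p θ m) := fun θ h0 hθ =>
    (lower θ h0 hθ).mono (besovPP_subset_besovInfty h0)
  exact ⟨iSup_ofReal_eq (fun θ h0 hθ => containsNonconstant_of_dense hVD (dense θ h0 hθ)) upper,
    iSup_ofReal_eq dense fun θ h0 hd => upper θ h0 (containsNonconstant_of_dense hVD hd),
    iSup_ofReal_eq (fun θ h0 hθ => containsNonconstant_of_dense hVD (lower θ h0 hθ))
      fun θ h0 hc => upper θ h0 (mono θ h0 hc),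
    iSup_ofReal_eq lower fun θ h0 hd =>
      upper θ h0 (mono θ h0 (containsNonconstant_of_dense hVD hd))⟩
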